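/- Let $n\ge 1$ and $m\ge 0$. Let $M$ be a non-compact smooth (Hausdorff) $n$-dimensional manifold without boundary and let $X:M\to\mathbb R^{n+m}$ be a proper smooth immersion; $M$ carries the induced Riemannian metric $g$ (which is automatically complete, because $X$ is proper) and its volume measure $d\mu$. Let $B(V,W)=(\overline\nabla_VW)^N$ be the second fundamental form and $H=\operatorname{trace}_g B$ the mean curvature vector, where $(\cdot)^N$ is the orthogonal projection to the normal space. Suppose that $X$ is a self-shrinker, that is, $$H=-\frac{X^N}{2}\quad\text{on } M .$$ For $r>0$ let $D_r=\{p\in M: |X(p)|<r\}$ be the part of $M$ in the open ball of radius $r$ centered at the origin. Then $M$ has at most Euclidean volume growth: there is a finite constant $C$, depending only on $n$ and on $\int_{D_{8n}}1\,d\mu$ (not on $m$, $M$ or $X$), such that $$\int_{D_r}1\,d\mu\le C\,r^n\qquad\text{for all } r\ge 1 .$$ -/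

import Mathlib

open MeasureTheory Module
open scoped Manifold ContDiff InnerProductSpace ENNReal NNReal

noncomputable section

namespace SelfShrinker

/-- Euclidean space `ℝᵏ` with the standard inner product. -/
abbrev Euc (k : ℕ) : Type := EuclideanSpace ℝ (Fin k)

section

variable {n k : ℕ} {M : Type*} [TopologicalSpace M]

/-- The local parametrization `X ∘ e⁻¹` (meaningful on `e.target`) of the map `X : M → ℝᵏ` in
the chart `e`. -/
def localParam (X : M → Euc k) (e : OpenPartialHomeomorph M (Euc n)) : Euc n → Euc k :=
  fun u => X (e.symm u)

/-- The coefficients `g_ij = ⟨∂_i (X ∘ e⁻¹), ∂_j (X ∘ e⁻¹)⟩` of the metric induced by `X`, in the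
chart `e`, at the coordinate point `u`. -/
def inducedMetric (X : M → Euc k) (e : OpenPartialHomeomorph M (Euc n)) (u : Euc n) :
    Matrix (Fin n) (Fin n) ℝ :=
  Matrix.gram ℝ fun i => fderiv ℝ (localParam X e) u (EuclideanSpace.single i 1)

/-- The volume element `√(det g) du` of the induced metric on the domain of the chart `e`, as a
measure on `M` that is concentrated on `e.source`. -/
def chartVolume [MeasurableSpace M] (X : M → Euc k) (e : OpenPartialHomeomorph M (Euc n)) :
    Measure M :=
  (((volume : Measure (Euc n)).restrict e.target).withDensity
    fun u => ENNReal.ofReal (Real.sqrt (inducedMetric X e u).det)).map e.symm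

theorem measurableSet_target_inter_preimage [MeasurableSpace M] [BorelSpace M]
    (e : OpenPartialHomeomorph M (Euc n)) {A : Set M} (hA : MeasurableSet A) :
    MeasurableSet (e.target ∩ e.symm ⁻¹' A) := by
  have h := (continuousOn_iff_continuous_domRestrict.1 e.continuousOn_symm).measurable hA
  have h2 := e.open_target.measurableSet.subtype_image h
  convert h2 using 1
  ext u
  simp [and_comm]

theorem chartVolume_apply [MeasurableSpace M] [BorelSpace M] (X : M → Euc k)
    (e : OpenPartialHomeomorph M (Euc n)) {A : Set M} (hA : MeasurableSet A) :
    chartVolume X e A = ∫⁻ u in e.target ∩ e.symm ⁻¹' A,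
      ENNReal.ofReal (Real.sqrt (inducedMetric X e u).det) := by
  have h1 : AEMeasurable e.symm ((volume : Measure (Euc n)).restrict e.target) :=
    e.continuousOn_symm.aemeasurable e.open_target.measurableSet
  rw [chartVolume, Measure.map_apply_of_aemeasurable
    (h1.mono_ac (withDensity_absolutelyContinuous _ _)) hA, withDensity_apply',
    Measure.restrict_restrict' e.open_target.measurableSet, Set.inter_comm]

theorem sqrt_det_inducedMetric (X : M → Euc k) (e : OpenPartialHomeomorph M (Euc n)) (u : Euc n) :
    Real.sqrt (inducedMetric X e u).det =
      ((fderiv ℝ (localParam X e) u : Euc n →L[ℝ] Euc k) : Euc n →ₗ[ℝ] Euc k).normDet := by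
  have h := LinearMap.normDet_sq_eq_det_gram
    ((fderiv ℝ (localParam X e) u : Euc n →L[ℝ] Euc k) : Euc n →ₗ[ℝ] Euc k)
    (EuclideanSpace.basisFun (Fin n) ℝ)
  have h2 : (inducedMetric X e u).det =
      ((fderiv ℝ (localParam X e) u : Euc n →L[ℝ] Euc k) : Euc n →ₗ[ℝ] Euc k).normDet ^ 2 := by
    simpa [inducedMetric] using h.symm
  rw [h2, Real.sqrt_sq (LinearMap.normDet_nonneg _)]

variable [ChartedSpace (Euc n) M]

variable (n) in
/-- The Riemannian volume measure `dμ` on `M` of the metric induced by `X : M → ℝᵏ`: the least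
measure on `M` that dominates the volume element of every chart of the atlas. The volume elements
of two charts agree on the overlap of their domains, so that this is the measure which is given by
`√(det g) du` in every chart: see `inducedVolume_restrict_source`. -/
def inducedVolume [MeasurableSpace M] (X : M → Euc k) : Measure M :=
  ⨆ e ∈ atlas (Euc n) M, chartVolume X e

/-! ### The volume measure is `√(det g) du` in every chart -/

theorem contDiffOn_localParam [IsManifold (𝓡 n) ∞ M] {X : M → Euc k}
    (hX : ContMDiff (𝓡 n) 𝓘(ℝ, Euc k) ∞ X) {e : OpenPartialHomeomorph M (Euc n)}
    (he : e ∈ atlas (Euc n) M) : ContDiffOn ℝ ∞ (localParam X e) e.target := by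
  rw [← contMDiffOn_iff_contDiffOn]
  exact hX.comp_contMDiffOn
    (contMDiffOn_symm_of_mem_maximalAtlas (IsManifold.subset_maximalAtlas he))

theorem contDiffOn_transition [IsManifold (𝓡 n) ∞ M] {e e' : OpenPartialHomeomorph M (Euc n)}
    (he : e ∈ atlas (Euc n) M) (he' : e' ∈ atlas (Euc n) M) :
    ContDiffOn ℝ ∞ (e'.symm.trans e) (e'.symm.trans e).source := by
  rw [← contMDiffOn_iff_contDiffOn]
  have h1 : ContMDiffOn (𝓡 n) (𝓡 n) ∞ e e.source :=
    contMDiffOn_of_mem_maximalAtlas (IsManifold.subset_maximalAtlas he)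
  have h2 : ContMDiffOn (𝓡 n) (𝓡 n) ∞ e'.symm e'.target :=
    contMDiffOn_symm_of_mem_maximalAtlas (IsManifold.subset_maximalAtlas he')
  refine h1.comp (h2.mono ?_) ?_
  · intro u hu
    exact hu.1
  · intro u hu
    exact hu.2

/-- The volume elements of two charts agree where both are defined. -/
theorem chartVolume_inter_source [MeasurableSpace M] [BorelSpace M] [IsManifold (𝓡 n) ∞ M]
    {X : M → Euc k} (hX : ContMDiff (𝓡 n) 𝓘(ℝ, Euc k) ∞ X)
    {e e' : OpenPartialHomeomorph M (Euc n)} (he : e ∈ atlas (Euc n) M)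
    (he' : e' ∈ atlas (Euc n) M) {A : Set M} (hA : MeasurableSet A) :
    chartVolume X e' (A ∩ e.source) = chartVolume X e (A ∩ e'.source) := by
  rw [chartVolume_apply X e' (hA.inter e.open_source.measurableSet),
    chartVolume_apply X e (hA.inter e'.open_source.measurableSet)]
  set φ := e'.symm.trans e with hφ
  set S := e'.target ∩ e'.symm ⁻¹' (A ∩ e.source) with hS
  have hSφ : S ⊆ φ.source := fun u hu => ⟨hu.1, hu.2.2⟩
  have hSm : MeasurableSet S :=
    measurableSet_target_inter_preimage e' (hA.inter e.open_source.measurableSet)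
  have himg : φ '' S = e.target ∩ e.symm ⁻¹' (A ∩ e'.source) := by
    ext v
    constructor
    · rintro ⟨u, ⟨hu1, hu2, hu3⟩, rfl⟩
      have h1 : φ u = e (e'.symm u) := rfl
      refine ⟨?_, ?_⟩
      · rw [h1]; exact e.map_source hu3
      · rw [h1, Set.mem_preimage, e.left_inv hu3]
        exact ⟨hu2, e'.map_target hu1⟩
    · rintro ⟨hv1, hv2, hv3⟩
      refine ⟨e' (e.symm v), ⟨e'.map_source hv3, ?_⟩, ?_⟩
      · rw [Set.mem_preimage, e'.left_inv hv3]
        exact ⟨hv2, e.map_target hv1⟩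
      · change e (e'.symm (e' (e.symm v))) = v
        rw [e'.left_inv hv3, e.right_inv hv1]
  have hd : ∀ u ∈ S, HasFDerivAt φ (fderiv ℝ φ u) u := fun u hu =>
    (((contDiffOn_transition he he').contDiffAt
      (φ.open_source.mem_nhds (hSφ hu))).differentiableAt (by simp)).hasFDerivAt
  rw [← himg, lintegral_image_eq_lintegral_abs_det_fderiv_mul volume hSm
    (fun u hu => (hd u hu).hasFDerivWithinAt) (φ.injOn.mono hSφ)]
  refine setLIntegral_congr_fun hSm fun u hu => ?_
  have hφt : φ u ∈ e.target := e.map_source hu.2.2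
  have hFe : HasFDerivAt (localParam X e) (fderiv ℝ (localParam X e) (φ u)) (φ u) :=
    (((contDiffOn_localParam hX he).contDiffAt
      (e.open_target.mem_nhds hφt)).differentiableAt (by simp)).hasFDerivAt
  have hev : localParam X e' =ᶠ[nhds u] localParam X e ∘ φ := by
    filter_upwards [φ.open_source.mem_nhds (hSφ hu)] with w hw
    change X (e'.symm w) = X (e.symm (e (e'.symm w)))
    exact congrArg X (e.left_inv hw.2).symm
  have hcomp : fderiv ℝ (localParam X e') u =
      (fderiv ℝ (localParam X e) (φ u)).comp (fderiv ℝ φ u) :=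
    ((hFe.comp u (hd u hu)).congr_of_eventuallyEq hev).fderiv
  simp only [sqrt_det_inducedMetric]
  rw [hcomp, ContinuousLinearMap.toLinearMap_comp, LinearMap.normDet_comp_of_finrank_eq _ _ rfl,
    LinearMap.normDet_eq_abs_det, mul_comm, ENNReal.ofReal_mul (abs_nonneg _)]

/-- In every chart of the atlas the volume measure is `√(det g) du`. -/
theorem inducedVolume_restrict_source [MeasurableSpace M] [BorelSpace M] [IsManifold (𝓡 n) ∞ M]
    {X : M → Euc k} (hX : ContMDiff (𝓡 n) 𝓘(ℝ, Euc k) ∞ X)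
    {e : OpenPartialHomeomorph M (Euc n)} (he : e ∈ atlas (Euc n) M) :
    (inducedVolume n X).restrict e.source = chartVolume X e := by
  have hself : ∀ A : Set M, MeasurableSet A →
      chartVolume X e (A ∩ e.source) = chartVolume X e A := fun A hA => by
    rw [chartVolume_apply X e (hA.inter e.open_source.measurableSet), chartVolume_apply X e hA]
    congr 2
    ext u
    exact ⟨fun h => ⟨h.1, h.2.1⟩, fun h => ⟨h.1, h.2, e.map_target h.1⟩⟩
  apply le_antisymm
  · have hle : inducedVolume n X ≤
        chartVolume X e + (⊤ : Measure M).restrict e.sourceᶜ := by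
      refine iSup₂_le fun e' he' => Measure.le_iff.2 fun A hA => ?_
      rw [← measure_inter_add_sdiff A e.open_source.measurableSet,
        chartVolume_inter_source hX he he' hA, Measure.add_apply,
        Measure.restrict_apply hA]
      refine add_le_add (measure_mono Set.inter_subset_left) ?_
      rw [Set.sdiff_eq]
      exact Measure.le_iff'.1 le_top _
    refine (Measure.restrict_mono le_rfl hle).trans (Measure.le_iff.2 fun A hA => ?_)
    rw [Measure.restrict_apply hA, Measure.add_apply, hself A hA,
      Measure.restrict_apply (hA.inter e.open_source.measurableSet)]
    simp [Set.inter_assoc]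
  · refine Measure.le_iff.2 fun A hA => ?_
    rw [Measure.restrict_apply hA, ← hself A hA]
    exact Measure.le_iff'.1 (le_iSup₂ (f := fun e _ => chartVolume X e) e he) _

variable (n) in
/-- The image `dX_p(T_p M) ⊆ ℝᵏ` of the tangent space at `p`. -/
def tangentImage (X : M → Euc k) (p : M) : Submodule ℝ (Euc k) :=
  (fderiv ℝ (localParam X (chartAt (Euc n) p)) (chartAt (Euc n) p p)).range

variable (n) in
/-- The orthogonal projection `v ↦ v^N` of `ℝᵏ` to the normal space of `X` at `p`. -/
def normalPart (X : M → Euc k) (p : M) (v : Euc k) : Euc k :=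
  (tangentImage n X p)ᗮ.starProjection v

/-- The second fundamental form `B(v, w) = (∇̄_v W)^N` of `X` at `p`, where `v` and `w` are given by
their components in the coordinates of the preferred chart at `p`: extending `w` to the vector
field `W` with constant components, `∇̄_v W` is the second derivative of the local parametrization
in the directions `v` and `w`. -/
def secondFundamentalForm (X : M → Euc k) (p : M) (v w : Euc n) : Euc k :=
  normalPart n X p
    (fderiv ℝ (fderiv ℝ (localParam X (chartAt (Euc n) p))) (chartAt (Euc n) p p) v w)

variable (n) in
/-- The mean curvature vector `H = trace B = ∑ g^{ij} B(∂_i, ∂_j)` of `X` at `p`. -/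
def meanCurvature (X : M → Euc k) (p : M) : Euc k :=
  ∑ i : Fin n, ∑ j : Fin n,
    (inducedMetric X (chartAt (Euc n) p) (chartAt (Euc n) p p))⁻¹ i j •
      secondFundamentalForm X p (EuclideanSpace.single i (1 : ℝ)) (EuclideanSpace.single j (1 : ℝ))

variable (n) in
/-- `X : M → ℝᵏ` is a smooth immersion of the smooth `n`-manifold `M`. -/
structure IsSmoothImmersion (X : M → Euc k) : Prop where
  contMDiff : ContMDiff (𝓡 n) 𝓘(ℝ, Euc k) ∞ X
  injective_mfderiv : ∀ p : M, Function.Injective (mfderiv (𝓡 n) 𝓘(ℝ, Euc k) X p)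

variable (n) in
/-- The self-shrinker equation `H = -X^N / 2`. -/
def IsSelfShrinker (X : M → Euc k) : Prop :=
  ∀ p : M, meanCurvature n X p = -(1 / 2 : ℝ) • normalPart n X p (X p)

end

end SelfShrinker

end

noncomputable section

namespace SelfShrinker

/-! ### Derivative of a determinant -/

/-! The proof compares Gaussian areas at different scales. For compactly supported `f`, the
divergence theorem applied to `f` times the tangential position field `X^T` gives `∫ f (n + ⟨H, X⟩)
+ ⟨∇f, X^T⟩ = 0`. The shrinker equation turns `⟨H, X⟩` into `-|X^N|²/2`; this is
`integral_weightedDiv_eq_zero`.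

Take `f = φ(|X|²) exp(-b²|X|²/4)` with `φ ≥ 0` a decreasing cut-off and `0 ≤ b ≤ 1`. The derivative
of `φ` contributes with a favourable sign, and `b² ≤ 1` permits replacing `|X^N|²` by `b²|X^N|²`.
Hence `∫ φ exp(-b²|X|²/4) (n - b²|X|²/2) ≥ 0` (`integral_gaussian_mul_nonneg`). Up to the factor
`b^(n-1)` this integral is the derivative in `b` of `b^n ∫ φ exp(-b²|X|²/4)`, which is therefore
nondecreasing on `(0, 1]` (`gaussian_area_le`).

The monotonicity is used twice. Let `J` be the integral at `b = 1` and `V` the volume of `D_{8n}`.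
Outside `D_{8n}` the weight at `b = 1` is at most `exp(-12n²)` times the weight at `b = 1/2`, so
comparing the two scales gives `J ≤ V + exp(-12n²) 2^n J ≤ V + J/2`, that is `J ≤ 2V`
(`integral_gaussian_le`). At `b = 1/r` the weight is bounded below on `D_r`, which gives `vol(D_r) ≤
3 r^n J ≤ 6 V r^n`. The cut-off makes every integral finite, and no constant depends on it.

The rest supplies the divergence theorem. It is computed in coordinates with Jacobi's formula, shown
to be independent of the chart, and globalized by a partition of unity. -/

theorem hasDerivAt_det_of_eq_one {ι : Type*} [Fintype ι] [DecidableEq ι]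
    {A : ℝ → Matrix ι ι ℝ} {A' : Matrix ι ι ℝ} {t : ℝ}
    (hA : ∀ i j, HasDerivAt (fun s => A s i j) (A' i j) t) (h1 : A t = 1) :
    HasDerivAt (fun s => (A s).det) A'.trace t := by
  simp only [Matrix.det_apply]
  have h : ∀ σ : Equiv.Perm ι, HasDerivAt
      (fun s => Equiv.Perm.sign σ • ∏ i, A s (σ i) i)
      (Equiv.Perm.sign σ • ∑ i, (∏ j ∈ Finset.univ.erase i, A t (σ j) j) • A' (σ i) i) t :=
    fun σ => (HasDerivAt.fun_finsetProd fun i _ => hA (σ i) i).const_smul _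
  refine (HasDerivAt.fun_sum fun σ _ => h σ).congr_deriv ?_
  -- Only the identity permutation contributes: any other moves at least two points, so after the
  -- differentiated factor is removed an off-diagonal entry of the identity matrix remains.
  rw [Finset.sum_eq_single 1]
  · simp [h1, Matrix.trace]
  · intro σ _ hσ
    rw [Finset.sum_eq_zero, smul_zero]
    intro i _
    obtain ⟨j, hji, hj⟩ : ∃ j, j ≠ i ∧ σ j ≠ j := by
      by_contra! hc
      refine hσ (Equiv.ext fun j => ?_)
      by_cases hji : j = i
      · subst hji
        by_contra hne
        exact hne (σ.injective (hc _ hne))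
      · exact hc j hji
    rw [Finset.prod_eq_zero (Finset.mem_erase.2 ⟨hji, Finset.mem_univ j⟩), zero_smul]
    rw [h1, Matrix.one_apply_ne hj]
  · simp

/-- Jacobi's formula. -/
theorem hasDerivAt_det {ι : Type*} [Fintype ι] [DecidableEq ι]
    {A : ℝ → Matrix ι ι ℝ} {A' : Matrix ι ι ℝ} {t : ℝ}
    (hA : ∀ i j, HasDerivAt (fun s => A s i j) (A' i j) t) (h : (A t).det ≠ 0) :
    HasDerivAt (fun s => (A s).det) ((A t).det * ((A t)⁻¹ * A').trace) t := by
  have hu : IsUnit (A t).det := isUnit_iff_ne_zero.2 h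
  have h1 := hasDerivAt_det_of_eq_one (A := fun s => (A t)⁻¹ * A s) (A' := (A t)⁻¹ * A') (t := t)
    (fun i j => by
      simp only [Matrix.mul_apply]
      exact HasDerivAt.fun_sum fun l _ => (hA l j).const_mul _)
    (Matrix.nonsing_inv_mul _ hu)
  refine (h1.const_mul (A t).det).congr_of_eventuallyEq (Filter.Eventually.of_forall fun s => ?_)
  simp only [Matrix.det_mul]
  rw [← mul_assoc, ← Matrix.det_mul, Matrix.mul_nonsing_inv _ hu, Matrix.det_one, one_mul]

/-! ### The induced geometry of a parametrization -/

section Param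

variable {n k : ℕ}

/-- The first partial derivative `∂_i F`. -/
def pderiv (F : Euc n → Euc k) (u : Euc n) (i : Fin n) : Euc k :=
  fderiv ℝ F u (EuclideanSpace.single i 1)

/-- The second partial derivative `∂_i ∂_j F`. -/
def pderiv₂ (F : Euc n → Euc k) (u : Euc n) (i j : Fin n) : Euc k :=
  fderiv ℝ (fderiv ℝ F) u (EuclideanSpace.single i 1) (EuclideanSpace.single j 1)

/-- The metric `⟨∂_i F, ∂_j F⟩` that is induced by the parametrization `F`. -/
def paramMetric (F : Euc n → Euc k) (u : Euc n) : Matrix (Fin n) (Fin n) ℝ :=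
  Matrix.gram ℝ (pderiv F u)

/-- The covariant components `⟨∂_j F, F⟩` of the tangential part of the position vector. -/
def posCov (F : Euc n → Euc k) (u : Euc n) (j : Fin n) : ℝ := ⟪pderiv F u j, F u⟫_ℝ

/-- The contravariant components of the tangential part of the position vector. -/
def posCoord (F : Euc n → Euc k) (u : Euc n) : Fin n → ℝ :=
  (paramMetric F u)⁻¹.mulVec (posCov F u)

/-- The tangential part of the position vector. -/
def posTangent (F : Euc n → Euc k) (u : Euc n) : Euc k := ∑ l, posCoord F u l • pderiv F u l

/-- The squared length of the tangential part of the position vector. -/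
def posTangentSq (F : Euc n → Euc k) (u : Euc n) : ℝ := ∑ l, posCoord F u l * posCov F u l

/-- The inner product of the mean curvature vector with the position vector. -/
def posMeanCurvature (F : Euc n → Euc k) (u : Euc n) : ℝ :=
  ∑ i, ∑ j, (paramMetric F u)⁻¹ i j * ⟪pderiv₂ F u i j, F u - posTangent F u⟫_ℝ

variable {F : Euc n → Euc k} {u : Euc n}

theorem fderiv_apply_eq_sum {E : Type*} [NormedAddCommGroup E] [NormedSpace ℝ E]
    (L : Euc n →L[ℝ] E) (v : Euc n) : L v = ∑ i, v i • L (EuclideanSpace.single i 1) := by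
  conv_lhs => rw [← (EuclideanSpace.basisFun (Fin n) ℝ).sum_repr v]
  simp

theorem linearIndependent_pderiv (hF : Function.Injective (fderiv ℝ F u)) :
    LinearIndependent ℝ (pderiv F u) := by
  have h := (EuclideanSpace.basisFun (Fin n) ℝ).toBasis.linearIndependent.map'
    (fderiv ℝ F u : Euc n →ₗ[ℝ] Euc k) (LinearMap.ker_eq_bot.2 hF)
  have h2 : ((fderiv ℝ F u : Euc n →ₗ[ℝ] Euc k) ∘ (EuclideanSpace.basisFun (Fin n) ℝ).toBasis) =
      pderiv F u := by
    ext i : 1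
    simp [pderiv]
  rw [← h2]
  exact h

theorem det_paramMetric_pos (hF : Function.Injective (fderiv ℝ F u)) :
    0 < (paramMetric F u).det :=
  (Matrix.posDef_gram_of_linearIndependent (linearIndependent_pderiv hF)).det_pos

theorem isUnit_det_paramMetric (hF : Function.Injective (fderiv ℝ F u)) :
    IsUnit (paramMetric F u).det := (det_paramMetric_pos hF).ne'.isUnit

theorem paramMetric_symm (i j : Fin n) : paramMetric F u i j = paramMetric F u j i :=
  real_inner_comm (pderiv F u j) (pderiv F u i)

theorem paramMetric_inv_symm (i j : Fin n) :
    (paramMetric F u)⁻¹ i j = (paramMetric F u)⁻¹ j i := by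
  have h : (paramMetric F u).transpose = paramMetric F u :=
    Matrix.ext fun i j => paramMetric_symm j i
  conv_lhs => rw [← h, ← Matrix.transpose_nonsing_inv, Matrix.transpose_apply]

theorem paramMetric_mulVec_posCoord (hF : Function.Injective (fderiv ℝ F u)) :
    (paramMetric F u).mulVec (posCoord F u) = posCov F u := by
  rw [posCoord, Matrix.mulVec_mulVec, Matrix.mul_nonsing_inv _ (isUnit_det_paramMetric hF),
    Matrix.one_mulVec]

theorem inner_pderiv_posTangent (hF : Function.Injective (fderiv ℝ F u)) (j : Fin n) :
    ⟪pderiv F u j, posTangent F u⟫_ℝ = posCov F u j := by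
  rw [← paramMetric_mulVec_posCoord hF, posTangent, inner_sum]
  simp only [inner_smul_right, Matrix.mulVec, dotProduct, paramMetric, Matrix.gram_apply]
  exact Finset.sum_congr rfl fun l _ => mul_comm _ _

theorem inner_pderiv_posNormal (hF : Function.Injective (fderiv ℝ F u)) (j : Fin n) :
    ⟪pderiv F u j, F u - posTangent F u⟫_ℝ = 0 := by
  rw [inner_sub_right, inner_pderiv_posTangent hF, posCov, sub_self]

theorem inner_fderiv_posNormal (hF : Function.Injective (fderiv ℝ F u)) (v : Euc n) :
    ⟪fderiv ℝ F u v, F u - posTangent F u⟫_ℝ = 0 := by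
  rw [fderiv_apply_eq_sum, sum_inner]
  refine Finset.sum_eq_zero fun i _ => ?_
  rw [inner_smul_left]
  exact mul_eq_zero_of_right _ (inner_pderiv_posNormal hF i)

theorem posTangent_eq_fderiv (F : Euc n → Euc k) (u : Euc n) :
    posTangent F u = fderiv ℝ F u (WithLp.toLp 2 (posCoord F u)) := by
  rw [fderiv_apply_eq_sum]
  rfl

theorem posTangentSq_eq_inner (F : Euc n → Euc k) (u : Euc n) :
    posTangentSq F u = ⟪posTangent F u, F u⟫_ℝ := by
  simp [posTangentSq, posTangent, sum_inner, inner_smul_left, posCov]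

theorem posTangentSq_eq_norm_sq (hF : Function.Injective (fderiv ℝ F u)) :
    posTangentSq F u = ‖posTangent F u‖ ^ 2 := by
  have h := inner_fderiv_posNormal hF (WithLp.toLp 2 (posCoord F u))
  rw [← posTangent_eq_fderiv, inner_sub_right, real_inner_self_eq_norm_sq] at h
  rw [posTangentSq_eq_inner]
  linarith

theorem norm_posNormal_sq (hF : Function.Injective (fderiv ℝ F u)) :
    ‖F u - posTangent F u‖ ^ 2 = ‖F u‖ ^ 2 - posTangentSq F u := by
  rw [norm_sub_sq_real, ← posTangentSq_eq_norm_sq hF, real_inner_comm, ← posTangentSq_eq_inner]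
  ring

/-- Links the abstract normal projection in the shrinker equation to the coordinate expression: the
difference is orthogonal to every tangent vector, and what was subtracted is tangent. -/
theorem starProjection_orthogonal_range (hF : Function.Injective (fderiv ℝ F u)) :
    (fderiv ℝ F u).rangeᗮ.starProjection (F u) = F u - posTangent F u := by
  refine Submodule.eq_starProjection_of_mem_orthogonal ?_ ?_
  · rw [Submodule.mem_orthogonal]
    rintro _ ⟨v, rfl⟩
    exact inner_fderiv_posNormal hF v
  · rw [sub_sub_cancel, posTangent_eq_fderiv]
    exact Submodule.le_orthogonal_orthogonal _ ⟨_, rfl⟩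

end Param

/-! ### Smoothness of determinants and inverse matrices -/

section Smooth

variable {E : Type*} [NormedAddCommGroup E] [NormedSpace ℝ E] {ι : Type*} [Fintype ι]
  [DecidableEq ι] {A : E → Matrix ι ι ℝ} {U : Set E}

theorem contDiffOn_det (hA : ∀ i j, ContDiffOn ℝ ∞ (fun u => A u i j) U) :
    ContDiffOn ℝ ∞ (fun u => (A u).det) U := by
  simp only [Matrix.det_apply]
  exact ContDiffOn.sum fun σ _ => (contDiffOn_prod fun i _ => hA (σ i) i).const_smul _

/-- Cramer's rule: the entries of the inverse are determinants divided by a nonvanishing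
determinant. -/
theorem contDiffOn_matrix_inv (hA : ∀ i j, ContDiffOn ℝ ∞ (fun u => A u i j) U)
    (hU : ∀ u ∈ U, (A u).det ≠ 0) (i j : ι) : ContDiffOn ℝ ∞ (fun u => (A u)⁻¹ i j) U := by
  simp only [Matrix.inv_def, Ring.inverse_eq_inv', Matrix.smul_apply, Matrix.adjugate_apply]
  refine ((contDiffOn_det hA).inv hU).smul (contDiffOn_det fun a b => ?_)
  by_cases ha : a = j
  · subst ha
    simpa using contDiffOn_const
  · simpa [Matrix.updateRow_ne ha] using hA a b

end Smooth

/-! ### Derivatives of the metric and the divergence of the tangential position field -/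

section Param

variable {n k : ℕ} {F : Euc n → Euc k} {U : Set (Euc n)} {u : Euc n}

theorem contDiffOn_pderiv (hU : IsOpen U) (hF : ContDiffOn ℝ ∞ F U) (i : Fin n) :
    ContDiffOn ℝ ∞ (fun u => pderiv F u i) U :=
  (hF.fderiv_of_isOpen hU (by simp)).clm_apply contDiffOn_const

theorem contDiffOn_paramMetric (hU : IsOpen U) (hF : ContDiffOn ℝ ∞ F U) (i j : Fin n) :
    ContDiffOn ℝ ∞ (fun u => paramMetric F u i j) U :=
  (contDiffOn_pderiv hU hF i).inner ℝ (contDiffOn_pderiv hU hF j)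

theorem contDiffOn_posCov (hU : IsOpen U) (hF : ContDiffOn ℝ ∞ F U) (i : Fin n) :
    ContDiffOn ℝ ∞ (fun u => posCov F u i) U :=
  (contDiffOn_pderiv hU hF i).inner ℝ hF

theorem contDiffOn_posCoord (hU : IsOpen U) (hF : ContDiffOn ℝ ∞ F U)
    (hinj : ∀ u ∈ U, Function.Injective (fderiv ℝ F u)) (i : Fin n) :
    ContDiffOn ℝ ∞ (fun u => posCoord F u i) U := by
  simp only [posCoord, Matrix.mulVec, dotProduct]
  exact ContDiffOn.sum fun j _ => (contDiffOn_matrix_inv (contDiffOn_paramMetric hU hF)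
    (fun u hu => (det_paramMetric_pos (hinj u hu)).ne') i j).mul (contDiffOn_posCov hU hF j)

theorem contDiffOn_posTangentSq (hU : IsOpen U) (hF : ContDiffOn ℝ ∞ F U)
    (hinj : ∀ u ∈ U, Function.Injective (fderiv ℝ F u)) :
    ContDiffOn ℝ ∞ (posTangentSq F) U :=
  ContDiffOn.sum fun j _ => (contDiffOn_posCoord hU hF hinj j).mul (contDiffOn_posCov hU hF j)

theorem contDiffOn_sqrt_det_paramMetric (hU : IsOpen U) (hF : ContDiffOn ℝ ∞ F U)
    (hinj : ∀ u ∈ U, Function.Injective (fderiv ℝ F u)) :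
    ContDiffOn ℝ ∞ (fun u => √(paramMetric F u).det) U :=
  (contDiffOn_det (contDiffOn_paramMetric hU hF)).sqrt
    fun u hu => (det_paramMetric_pos (hinj u hu)).ne'

theorem pderiv₂_symm (hF : ContDiffAt ℝ ∞ F u) (i j : Fin n) :
    pderiv₂ F u i j = pderiv₂ F u j i :=
  (hF.isSymmSndFDerivAt (by simpa using ENat.LEInfty.out)).eq _ _

theorem hasLineDerivAt_pderiv (hF : ContDiffAt ℝ ∞ F u) (i j : Fin n) :
    HasLineDerivAt ℝ (fun u => pderiv F u j) (pderiv₂ F u i j) u (EuclideanSpace.single i 1) := by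
  have h : HasFDerivAt (fderiv ℝ F) (fderiv ℝ (fderiv ℝ F) u) u :=
    ((hF.fderiv_right (m := ∞) (by simp)).differentiableAt
      (by simp)).hasFDerivAt
  exact (h.clm_apply (hasFDerivAt_const (EuclideanSpace.single j (1 : ℝ)) u)).hasLineDerivAt _
    |>.congr_deriv (by simp [pderiv₂])

theorem hasLineDerivAt_param (hF : ContDiffAt ℝ ∞ F u) (i : Fin n) :
    HasLineDerivAt ℝ F (pderiv F u i) u (EuclideanSpace.single i 1) :=
  (hF.differentiableAt (by simp)).hasFDerivAt.hasLineDerivAt _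

/-- The partial derivative `∂_i` of the metric. -/
def metricDeriv (F : Euc n → Euc k) (u : Euc n) (i : Fin n) : Matrix (Fin n) (Fin n) ℝ :=
  Matrix.of fun a b => ⟪pderiv F u a, pderiv₂ F u i b⟫_ℝ + ⟪pderiv₂ F u i a, pderiv F u b⟫_ℝ

theorem hasLineDerivAt_paramMetric (hF : ContDiffAt ℝ ∞ F u) (i a b : Fin n) :
    HasLineDerivAt ℝ (fun u => paramMetric F u a b) (metricDeriv F u i a b) u
      (EuclideanSpace.single i 1) := by
  have h := HasDerivAt.inner ℝ (hasLineDerivAt_pderiv hF i a) (hasLineDerivAt_pderiv hF i b)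
  refine HasDerivAt.congr_deriv h ?_
  simp [metricDeriv]

theorem hasLineDerivAt_posCov (hF : ContDiffAt ℝ ∞ F u) (i j : Fin n) :
    HasLineDerivAt ℝ (fun u => posCov F u j)
      (paramMetric F u j i + ⟪pderiv₂ F u i j, F u⟫_ℝ) u (EuclideanSpace.single i 1) := by
  have h := HasDerivAt.inner ℝ (hasLineDerivAt_pderiv hF i j) (hasLineDerivAt_param hF i)
  refine HasDerivAt.congr_deriv h ?_
  simp [paramMetric, Matrix.gram_apply]

theorem hasLineDerivAt_sqrt_det (hF : ContDiffAt ℝ ∞ F u)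
    (hinj : Function.Injective (fderiv ℝ F u)) (i : Fin n) :
    HasLineDerivAt ℝ (fun u => √(paramMetric F u).det)
      (√(paramMetric F u).det * (((paramMetric F u)⁻¹ * metricDeriv F u i).trace / 2)) u
      (EuclideanSpace.single i 1) := by
  have hpos := det_paramMetric_pos hinj
  have h := hasDerivAt_det (A := fun s : ℝ => paramMetric F (u + s • EuclideanSpace.single i 1))
    (t := 0) (hasLineDerivAt_paramMetric hF i) (by simpa using hpos.ne')
  have h2 := h.sqrt (by simpa using hpos.ne')
  refine HasDerivAt.congr_deriv h2 ?_
  simp only [zero_smul, add_zero]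
  have hs : √(paramMetric F u).det ≠ 0 := (Real.sqrt_pos.2 hpos).ne'
  field_simp
  rw [Real.sq_sqrt hpos.le, mul_comm]

/-- The derivative of the tangential components, from differentiating `g ξ = a`. -/
theorem fderiv_posCoord (hF : ContDiffAt ℝ ∞ F u)
    (hinj : ∀ᶠ v in nhds u, Function.Injective (fderiv ℝ F v)) {x' : Fin n → ℝ} {i : Fin n}
    (hx : ∀ l, HasLineDerivAt ℝ (fun v => posCoord F v l) (x' l) u (EuclideanSpace.single i 1)) :
    x' = (paramMetric F u)⁻¹.mulVec fun j => paramMetric F u j i + ⟪pderiv₂ F u i j, F u⟫_ℝ -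
      ∑ l, metricDeriv F u i j l * posCoord F u l := by
  have hu := isUnit_det_paramMetric hinj.self_of_nhds
  have key : (paramMetric F u).mulVec x' = fun j =>
      paramMetric F u j i + ⟪pderiv₂ F u i j, F u⟫_ℝ -
      ∑ l, metricDeriv F u i j l * posCoord F u l := by
    funext j
    have h1 : HasLineDerivAt ℝ (fun v => ∑ l, paramMetric F v j l * posCoord F v l)
        (∑ l, (metricDeriv F u i j l * posCoord F u l + paramMetric F u j l * x' l)) u
        (EuclideanSpace.single i 1) := by
      have := HasDerivAt.fun_sum (u := Finset.univ) fun l _ =>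
        HasDerivAt.mul (hasLineDerivAt_paramMetric hF i j l) (hx l)
      refine HasDerivAt.congr_deriv this ?_
      simp
    have h2 : (fun v => ∑ l, paramMetric F v j l * posCoord F v l) =ᶠ[nhds u]
        fun v => posCov F v j := by
      filter_upwards [hinj] with v hv
      exact congrFun (paramMetric_mulVec_posCoord hv) j
    have h3 := (h2.hasLineDerivAt_iff.1 h1).lineDeriv.symm.trans
      (hasLineDerivAt_posCov hF i j).lineDeriv
    rw [Finset.sum_add_distrib] at h3
    simp only [Matrix.mulVec, dotProduct]
    linarith
  rw [← key, Matrix.mulVec_mulVec, Matrix.nonsing_inv_mul _ hu, Matrix.one_mulVec]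

/-- The divergence of the tangential part of the position vector is `n + ⟨H, F⟩`. -/
theorem sum_deriv_sqrt_det_mul_posCoord (hF : ContDiffAt ℝ ∞ F u)
    (hinj : ∀ᶠ v in nhds u, Function.Injective (fderiv ℝ F v)) {x' : Fin n → Fin n → ℝ}
    (hx : ∀ i l, HasLineDerivAt ℝ (fun v => posCoord F v l) (x' i l) u
      (EuclideanSpace.single i 1)) :
    ∑ i, (((paramMetric F u)⁻¹ * metricDeriv F u i).trace / 2 * posCoord F u i + x' i i) =
      n + posMeanCurvature F u := by
  have hu := isUnit_det_paramMetric hinj.self_of_nhds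
  set g := paramMetric F u with hg
  set ξ := posCoord F u with hξ
  -- By symmetry of the inverse metric, the two halves of the metric derivative have the same trace;
  -- this is the contracted Christoffel symbol.
  have htr : ∀ i, (g⁻¹ * metricDeriv F u i).trace / 2 =
      ∑ a, ∑ j, g⁻¹ a j * ⟪pderiv F u j, pderiv₂ F u i a⟫_ℝ := by
    intro i
    have : (g⁻¹ * metricDeriv F u i).trace =
        ∑ a, ∑ j, g⁻¹ a j * ⟪pderiv F u j, pderiv₂ F u i a⟫_ℝ +
        ∑ a, ∑ j, g⁻¹ a j * ⟪pderiv F u a, pderiv₂ F u i j⟫_ℝ := by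
      simp only [Matrix.trace, Matrix.diag, Matrix.mul_apply, metricDeriv, Matrix.of_apply,
        ← Finset.sum_add_distrib]
      refine Finset.sum_congr rfl fun a _ => Finset.sum_congr rfl fun j _ => ?_
      rw [real_inner_comm (pderiv F u a), mul_add]
    rw [this, Finset.sum_comm (f := fun a j => g⁻¹ a j * ⟪pderiv F u a, pderiv₂ F u i j⟫_ℝ)]
    have h2 : ∀ a j, g⁻¹ j a * ⟪pderiv F u j, pderiv₂ F u i a⟫_ℝ =
      g⁻¹ a j * ⟪pderiv F u j, pderiv₂ F u i a⟫_ℝ := fun a j => by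
        rw [hg, paramMetric_inv_symm]
    simp only [h2]
    ring
  -- One half of the metric derivative combines with `⟨∂_i ∂_j F, F⟩` into a pairing with the normal
  -- part of `F`, whose trace is the mean curvature term. The other half is a Christoffel term.
  have hxi : ∀ i, x' i i = ∑ j, g⁻¹ i j * g j i +
      ∑ j, g⁻¹ i j * ⟪pderiv₂ F u i j, F u - posTangent F u⟫_ℝ -
      ∑ j, g⁻¹ i j * ∑ l, ⟪pderiv F u j, pderiv₂ F u i l⟫_ℝ * ξ l := by
    intro i
    rw [fderiv_posCoord hF hinj (hx i), Matrix.mulVec, dotProduct, ← Finset.sum_add_distrib,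
      ← Finset.sum_sub_distrib]
    refine Finset.sum_congr rfl fun j _ => ?_
    have : ⟪pderiv₂ F u i j, posTangent F u⟫_ℝ = ∑ l, ⟪pderiv₂ F u i j, pderiv F u l⟫_ℝ * ξ l := by
      rw [posTangent, inner_sum]
      refine Finset.sum_congr rfl fun l _ => ?_
      rw [inner_smul_right, mul_comm]
    rw [inner_sub_right, this]
    simp only [metricDeriv, Matrix.of_apply, add_mul, Finset.sum_add_distrib]
    ring
  have hn : ∑ i, ∑ j, g⁻¹ i j * g j i = n := by
    have : (g⁻¹ * g).trace = n := by rw [Matrix.nonsing_inv_mul _ hu]; simp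
    simpa [Matrix.trace, Matrix.mul_apply] using this
  -- After the indices are renamed, the two Christoffel contributions agree because second partial
  -- derivatives commute.
  have hcancel : ∑ i, (∑ a, ∑ j, g⁻¹ a j * ⟪pderiv F u j, pderiv₂ F u i a⟫_ℝ) * ξ i =
      ∑ i, ∑ j, g⁻¹ i j * ∑ l, ⟪pderiv F u j, pderiv₂ F u i l⟫_ℝ * ξ l := by
    simp only [Finset.sum_mul, Finset.mul_sum]
    rw [Finset.sum_comm]
    refine Finset.sum_congr rfl fun a _ => ?_
    rw [Finset.sum_comm]
    refine Finset.sum_congr rfl fun j _ => Finset.sum_congr rfl fun l _ => ?_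
    rw [pderiv₂_symm hF l a, mul_assoc]
  simp only [htr, hxi, Finset.sum_add_distrib, Finset.sum_sub_distrib]
  rw [hn, hcancel, posMeanCurvature]
  ring

end Param

/-! ### Divergence theorem in a parametrization -/

section Param

variable {n k : ℕ} {F : Euc n → Euc k} {U : Set (Euc n)} {u : Euc n}

/-- The derivative of `f` in the direction of the tangential part of the position vector of `F`. -/
def posDeriv (F : Euc n → Euc k) (f : Euc n → ℝ) (u : Euc n) : ℝ :=
  fderiv ℝ f u (WithLp.toLp 2 (posCoord F u))

/-- Integration by parts against the constant function `1`. -/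
theorem integral_fderiv_eq_zero_of_hasCompactSupport {w : Euc n → ℝ} (hw : ContDiff ℝ 1 w)
    (hc : HasCompactSupport w) (v : Euc n) : ∫ u, fderiv ℝ w u v = 0 := by
  have hd : Integrable (fun u => fderiv ℝ w u v) :=
    ((hw.continuous_fderiv (by simp)).clm_apply continuous_const).integrable_of_hasCompactSupport
      (hc.fderiv_apply (𝕜 := ℝ) v)
  have h := integral_mul_fderiv_eq_neg_fderiv_mul_of_integrable (μ := volume) (f := w)
    (g := fun _ => (1 : ℝ)) (v := v) (by simpa using hd) (by simp)
    (by simpa using hw.continuous.integrable_of_hasCompactSupport hc)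
    (fun u _ => (hw.differentiable (by simp)) u) (fun u _ => differentiableAt_const _)
  simpa using h

theorem posDeriv_eq_sum (F : Euc n → Euc k) (f : Euc n → ℝ) (u : Euc n) :
    posDeriv F f u = ∑ i, posCoord F u i * fderiv ℝ f u (EuclideanSpace.single i 1) := by
  rw [posDeriv, fderiv_apply_eq_sum]
  rfl

theorem sum_fderiv_mul_sqrt_det_mul_posCoord (hU : IsOpen U) (hF : ContDiffOn ℝ ∞ F U)
    (hinj : ∀ u ∈ U, Function.Injective (fderiv ℝ F u)) {f : Euc n → ℝ}
    (hu : u ∈ U) (hf : DifferentiableAt ℝ f u) :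
    ∑ i, fderiv ℝ (fun v => f v * (√(paramMetric F v).det * posCoord F v i)) u
      (EuclideanSpace.single i 1) =
    √(paramMetric F u).det * (f u * (n + posMeanCurvature F u) + posDeriv F f u) := by
  have hFu : ContDiffAt ℝ ∞ F u := hF.contDiffAt (hU.mem_nhds hu)
  have hs : DifferentiableAt ℝ (fun v => √(paramMetric F v).det) u :=
    ((contDiffOn_sqrt_det_paramMetric hU hF hinj).contDiffAt (hU.mem_nhds hu)).differentiableAt
      (by simp)
  have hx : ∀ i, DifferentiableAt ℝ (fun v => posCoord F v i) u := fun i =>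
    ((contDiffOn_posCoord hU hF hinj i).contDiffAt (hU.mem_nhds hu)).differentiableAt (by simp)
  have hdiv := sum_deriv_sqrt_det_mul_posCoord hFu
    (by filter_upwards [hU.mem_nhds hu] with v hv using hinj v hv)
    (fun i l => (hx l).hasFDerivAt.hasLineDerivAt (EuclideanSpace.single i 1))
  have hsd : ∀ i, fderiv ℝ (fun v => √(paramMetric F v).det) u (EuclideanSpace.single i 1) =
      √(paramMetric F u).det * (((paramMetric F u)⁻¹ * metricDeriv F u i).trace / 2) := fun i =>
    (hs.hasFDerivAt.hasLineDerivAt _).lineDeriv.symm.trans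
      (hasLineDerivAt_sqrt_det hFu (hinj u hu) i).lineDeriv
  rw [← hdiv, posDeriv_eq_sum, Finset.mul_sum, ← Finset.sum_add_distrib, Finset.mul_sum]
  refine Finset.sum_congr rfl fun i _ => ?_
  rw [(hf.hasFDerivAt.fun_mul (hs.hasFDerivAt.fun_mul (hx i).hasFDerivAt)).fderiv]
  simp only [add_apply, smul_apply, smul_eq_mul, hsd]
  ring

/-- The divergence theorem for the tangential part of the position vector, multiplied by a
compactly supported function, in a parametrization. -/
theorem setIntegral_sqrt_det_mul_eq_zero (hU : IsOpen U) (hF : ContDiffOn ℝ ∞ F U)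
    (hinj : ∀ u ∈ U, Function.Injective (fderiv ℝ F u)) {f : Euc n → ℝ}
    (hf : ContDiffOn ℝ ∞ f U) {K : Set (Euc n)} (hK : IsCompact K) (hKU : K ⊆ U)
    (hfK : ∀ u ∈ U, u ∉ K → f u = 0) :
    ∫ u in U, √(paramMetric F u).det *
      (f u * (n + posMeanCurvature F u) + posDeriv F f u) = 0 := by
  -- The integrand makes sense only on `U`, so it is extended by zero. The extension is smooth
  -- because it already vanishes off the compact set `K ⊆ U`.
  set w : Fin n → Euc n → ℝ := fun i => U.indicator
    fun v => f v * (√(paramMetric F v).det * posCoord F v i) with hw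
  have hwK : ∀ i, ∀ u ∉ K, w i u = 0 := fun i u hu => by
    by_cases huU : u ∈ U
    · simp [hw, huU, hfK u huU hu]
    · simp [hw, huU]
  have hw0 : ∀ i, ∀ u ∉ K, w i =ᶠ[nhds u] fun _ => 0 := fun i u hu => by
    filter_upwards [hK.isClosed.isOpen_compl.mem_nhds hu] with v hv using hwK i v hv
  have hwU : ∀ i, ∀ u ∈ U, w i =ᶠ[nhds u]
      fun v => f v * (√(paramMetric F v).det * posCoord F v i) := fun i u hu => by
    filter_upwards [hU.mem_nhds hu] with v hv using Set.indicator_of_mem hv _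
  have hwc : ∀ i, HasCompactSupport (w i) := fun i => HasCompactSupport.intro hK (hwK i)
  have hws : ∀ i, ContDiff ℝ 1 (w i) := fun i => contDiff_iff_contDiffAt.2 fun u => by
    by_cases huK : u ∈ K
    · have hu := hU.mem_nhds (hKU huK)
      refine ContDiffAt.congr_of_eventuallyEq ?_ (hwU i u (hKU huK))
      exact ((hf.contDiffAt hu).mul
        (((contDiffOn_sqrt_det_paramMetric hU hF hinj).contDiffAt hu).mul
        ((contDiffOn_posCoord hU hF hinj i).contDiffAt hu))).of_le (by simp)
    · exact contDiffAt_const.congr_of_eventuallyEq (hw0 i u huK)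
  have hint : ∫ u, ∑ i, fderiv ℝ (w i) u (EuclideanSpace.single i 1) = 0 := by
    rw [integral_finsetSum]
    · exact Finset.sum_eq_zero fun i _ =>
        integral_fderiv_eq_zero_of_hasCompactSupport (hws i) (hwc i) _
    · exact fun i _ => (((hws i).continuous_fderiv (by simp)).clm_apply
        continuous_const).integrable_of_hasCompactSupport ((hwc i).fderiv_apply (𝕜 := ℝ) _)
  refine Eq.trans (Eq.symm ?_) hint
  rw [← setIntegral_eq_integral_of_forall_compl_eq_zero (s := U)]
  · refine setIntegral_congr_fun hU.measurableSet fun u hu => ?_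
    refine Eq.trans ?_ (sum_fderiv_mul_sqrt_det_mul_posCoord hU hF hinj hu
      ((hf.contDiffAt (hU.mem_nhds hu)).differentiableAt (by simp)))
    exact Finset.sum_congr rfl fun i _ => by rw [(hwU i u hu).fderiv_eq]
  · intro u hu
    refine Finset.sum_eq_zero fun i _ => ?_
    rw [(hw0 i u fun h => hu (hKU h)).fderiv_eq]
    simp

/-! ### Change of the parametrization -/

variable {F' : Euc n → Euc k} {φ : Euc n → Euc n}

/-- The Jacobian matrix of `φ`. -/
def jacobian (φ : Euc n → Euc n) (u : Euc n) : Matrix (Fin n) (Fin n) ℝ :=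
  Matrix.of fun a i => fderiv ℝ φ u (EuclideanSpace.single i 1) a

theorem fderiv_eq_comp (hF : ContDiffAt ℝ ∞ F (φ u)) (hφ : ContDiffAt ℝ ∞ φ u)
    (h : F' =ᶠ[nhds u] F ∘ φ) : fderiv ℝ F' u = (fderiv ℝ F (φ u)).comp (fderiv ℝ φ u) := by
  rw [h.fderiv_eq]
  exact fderiv_comp u (hF.differentiableAt (by simp)) (hφ.differentiableAt (by simp))

theorem pderiv_comp (hF : ContDiffAt ℝ ∞ F (φ u)) (hφ : ContDiffAt ℝ ∞ φ u)
    (h : F' =ᶠ[nhds u] F ∘ φ) (i : Fin n) :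
    pderiv F' u i = ∑ a, jacobian φ u a i • pderiv F (φ u) a := by
  rw [pderiv, fderiv_eq_comp hF hφ h, ContinuousLinearMap.comp_apply, fderiv_apply_eq_sum]
  rfl

theorem paramMetric_comp (hF : ContDiffAt ℝ ∞ F (φ u)) (hφ : ContDiffAt ℝ ∞ φ u)
    (h : F' =ᶠ[nhds u] F ∘ φ) :
    paramMetric F' u = (jacobian φ u).transpose * paramMetric F (φ u) * jacobian φ u := by
  ext i j
  rw [paramMetric, Matrix.gram_apply, pderiv_comp hF hφ h, pderiv_comp hF hφ h, sum_inner]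
  simp only [inner_sum, inner_smul_left, inner_smul_right, Matrix.mul_apply, Finset.sum_mul,
    Matrix.transpose_apply, paramMetric, Matrix.gram_apply]
  rw [Finset.sum_comm]
  refine Finset.sum_congr rfl fun a _ => Finset.sum_congr rfl fun b _ => ?_
  simp only [conj_trivial]
  ring

theorem posCov_comp (hF : ContDiffAt ℝ ∞ F (φ u)) (hφ : ContDiffAt ℝ ∞ φ u)
    (h : F' =ᶠ[nhds u] F ∘ φ) :
    posCov F' u = (jacobian φ u).transpose.mulVec (posCov F (φ u)) := by
  ext i
  have h0 : F' u = F (φ u) := h.self_of_nhds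
  rw [posCov, pderiv_comp hF hφ h, h0, sum_inner]
  simp [inner_smul_left, Matrix.mulVec, dotProduct, posCov]

/-- The derivative of `φ` is an injective endomorphism of a finite-dimensional space, hence
surjective, so it can be cancelled on the right. -/
theorem injective_fderiv_of_comp (hF : ContDiffAt ℝ ∞ F (φ u)) (hφ : ContDiffAt ℝ ∞ φ u)
    (h : F' =ᶠ[nhds u] F ∘ φ) (hinj : Function.Injective (fderiv ℝ F' u)) :
    Function.Injective (fderiv ℝ F (φ u)) := by
  rw [fderiv_eq_comp hF hφ h, ContinuousLinearMap.coe_comp] at hinj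
  have h1 : Function.Injective (fderiv ℝ φ u : Euc n →ₗ[ℝ] Euc n) := hinj.of_comp
  have h2 : Function.Surjective (fderiv ℝ φ u : Euc n →ₗ[ℝ] Euc n) :=
    LinearMap.injective_iff_surjective.1 h1
  exact Function.Injective.of_comp_right hinj h2

theorem isUnit_det_jacobian (hF : ContDiffAt ℝ ∞ F (φ u)) (hφ : ContDiffAt ℝ ∞ φ u)
    (h : F' =ᶠ[nhds u] F ∘ φ) (hinj : Function.Injective (fderiv ℝ F' u)) :
    IsUnit (jacobian φ u).det := by
  have h1 := (det_paramMetric_pos hinj).ne'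
  rw [paramMetric_comp hF hφ h, Matrix.det_mul] at h1
  exact (right_ne_zero_of_mul h1).isUnit

theorem inv_paramMetric_comp (hF : ContDiffAt ℝ ∞ F (φ u)) (hφ : ContDiffAt ℝ ∞ φ u)
    (h : F' =ᶠ[nhds u] F ∘ φ) :
    (paramMetric F' u)⁻¹ =
      (jacobian φ u)⁻¹ * ((paramMetric F (φ u))⁻¹ * (jacobian φ u)⁻¹.transpose) := by
  rw [paramMetric_comp hF hφ h, Matrix.mul_inv_rev, Matrix.mul_inv_rev,
    Matrix.transpose_nonsing_inv]

theorem posCoord_comp (hF : ContDiffAt ℝ ∞ F (φ u)) (hφ : ContDiffAt ℝ ∞ φ u)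
    (h : F' =ᶠ[nhds u] F ∘ φ) (hinj : Function.Injective (fderiv ℝ F' u)) :
    (jacobian φ u).mulVec (posCoord F' u) = posCoord F (φ u) := by
  have hJ := isUnit_det_jacobian hF hφ h hinj
  have hJ' : IsUnit (jacobian φ u).transpose.det := by rwa [Matrix.det_transpose]
  rw [posCoord, posCoord, inv_paramMetric_comp hF hφ h, posCov_comp hF hφ h,
    Matrix.mulVec_mulVec, Matrix.mulVec_mulVec, Matrix.transpose_nonsing_inv]
  congr 1
  rw [← mul_assoc, ← mul_assoc, Matrix.mul_nonsing_inv _ hJ, one_mul, mul_assoc,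
    Matrix.nonsing_inv_mul _ hJ', mul_one]

/-- The tangential position vector transforms as a vector field under `φ`. The invariance of its
length and of the derivative along it follows. -/
theorem fderiv_posCoord_comp (hF : ContDiffAt ℝ ∞ F (φ u)) (hφ : ContDiffAt ℝ ∞ φ u)
    (h : F' =ᶠ[nhds u] F ∘ φ) (hinj : Function.Injective (fderiv ℝ F' u)) :
    fderiv ℝ φ u (WithLp.toLp 2 (posCoord F' u)) = WithLp.toLp 2 (posCoord F (φ u)) := by
  rw [← posCoord_comp hF hφ h hinj, fderiv_apply_eq_sum]
  ext a
  simp [Matrix.mulVec, dotProduct, jacobian, mul_comm]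

theorem posTangent_comp (hF : ContDiffAt ℝ ∞ F (φ u)) (hφ : ContDiffAt ℝ ∞ φ u)
    (h : F' =ᶠ[nhds u] F ∘ φ) (hinj : Function.Injective (fderiv ℝ F' u)) :
    posTangent F' u = posTangent F (φ u) := by
  rw [posTangent_eq_fderiv, posTangent_eq_fderiv, fderiv_eq_comp hF hφ h,
    ContinuousLinearMap.comp_apply, fderiv_posCoord_comp hF hφ h hinj]

theorem posTangentSq_comp (hF : ContDiffAt ℝ ∞ F (φ u)) (hφ : ContDiffAt ℝ ∞ φ u)
    (h : F' =ᶠ[nhds u] F ∘ φ) (hinj : Function.Injective (fderiv ℝ F' u)) :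
    posTangentSq F' u = posTangentSq F (φ u) := by
  rw [posTangentSq_eq_inner, posTangentSq_eq_inner, posTangent_comp hF hφ h hinj,
    h.self_of_nhds, Function.comp_apply]

theorem posDeriv_comp (hF : ContDiffAt ℝ ∞ F (φ u)) (hφ : ContDiffAt ℝ ∞ φ u)
    (h : F' =ᶠ[nhds u] F ∘ φ) (hinj : Function.Injective (fderiv ℝ F' u)) {f f' : Euc n → ℝ}
    (hf : DifferentiableAt ℝ f (φ u)) (h' : f' =ᶠ[nhds u] f ∘ φ) :
    posDeriv F' f' u = posDeriv F f (φ u) := by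
  rw [posDeriv, posDeriv, h'.fderiv_eq, fderiv_comp u hf (hφ.differentiableAt (by simp)),
    ContinuousLinearMap.comp_apply, fderiv_posCoord_comp hF hφ h hinj]

/-- Second-order chain rule. The extra term is tangent to the image, so it disappears when paired
with a normal vector. -/
theorem fderiv_fderiv_comp_apply (hF : ContDiffAt ℝ ∞ F (φ u)) (hφ : ContDiffAt ℝ ∞ φ u)
    (h : F' =ᶠ[nhds u] F ∘ φ) (v w : Euc n) :
    fderiv ℝ (fderiv ℝ F') u v w =
      fderiv ℝ (fderiv ℝ F) (φ u) (fderiv ℝ φ u v) (fderiv ℝ φ u w) +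
        fderiv ℝ F (φ u) (fderiv ℝ (fderiv ℝ φ) u v w) := by
  have hev : fderiv ℝ F' =ᶠ[nhds u] fun x => (fderiv ℝ F (φ x)).comp (fderiv ℝ φ x) := by
    have h1 : ∀ᶠ x in nhds u, ContDiffAt ℝ 1 F (φ x) :=
      hφ.continuousAt.eventually ((hF.of_le (m := 1) (by simp)).eventually (by simp))
    filter_upwards [h.eventually_nhds, h1,
      (hφ.of_le (m := 1) (by simp)).eventually (by simp)] with x hx hx1 hx2
    rw [Filter.EventuallyEq.fderiv_eq hx]
    exact fderiv_comp x (hx1.differentiableAt (by simp)) (hx2.differentiableAt (by simp))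
  have hF2 : HasFDerivAt (fderiv ℝ F) (fderiv ℝ (fderiv ℝ F) (φ u)) (φ u) :=
    ((hF.fderiv_right (m := ∞) (by simp)).differentiableAt (by simp)).hasFDerivAt
  have hφ2 : HasFDerivAt (fderiv ℝ φ) (fderiv ℝ (fderiv ℝ φ) u) u :=
    ((hφ.fderiv_right (m := ∞) (by simp)).differentiableAt (by simp)).hasFDerivAt
  have hφ1 : HasFDerivAt φ (fderiv ℝ φ u) u := (hφ.differentiableAt (by simp)).hasFDerivAt
  have h2 : HasFDerivAt (fun x => (fderiv ℝ F (φ x)).comp (fderiv ℝ φ x)) _ u :=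
    (hF2.comp u hφ1).clm_comp hφ2
  rw [hev.fderiv_eq, h2.fderiv]
  simp [add_comm]

theorem inner_pderiv₂_comp (hF : ContDiffAt ℝ ∞ F (φ u)) (hφ : ContDiffAt ℝ ∞ φ u)
    (h : F' =ᶠ[nhds u] F ∘ φ) {N : Euc k} (hN : ∀ v, ⟪fderiv ℝ F (φ u) v, N⟫_ℝ = 0) :
    (Matrix.of fun i j => ⟪pderiv₂ F' u i j, N⟫_ℝ) = (jacobian φ u).transpose *
      (Matrix.of fun i j => ⟪pderiv₂ F (φ u) i j, N⟫_ℝ) * jacobian φ u := by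
  ext i j
  rw [Matrix.of_apply, pderiv₂, fderiv_fderiv_comp_apply hF hφ h, inner_add_left, hN, add_zero,
    fderiv_apply_eq_sum _ (fderiv ℝ φ u (EuclideanSpace.single j 1)), sum_inner]
  simp only [Matrix.mul_apply, Matrix.of_apply, Matrix.transpose_apply]
  refine Finset.sum_congr rfl fun b _ => ?_
  rw [inner_smul_left, fderiv_apply_eq_sum _ (fderiv ℝ φ u (EuclideanSpace.single i 1)),
    sum_apply, sum_inner]
  simp only [smul_apply, inner_smul_left, jacobian, Matrix.of_apply,
    conj_trivial, pderiv₂]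
  ring

/-- The inverse metric and the normal second derivatives transform by inverse congruences, and the
trace of their product is unchanged by cyclicity. -/
theorem posMeanCurvature_comp (hF : ContDiffAt ℝ ∞ F (φ u)) (hφ : ContDiffAt ℝ ∞ φ u)
    (h : F' =ᶠ[nhds u] F ∘ φ) (hinj : Function.Injective (fderiv ℝ F' u)) :
    posMeanCurvature F' u = posMeanCurvature F (φ u) := by
  have hJ := isUnit_det_jacobian hF hφ h hinj
  have hJ' : IsUnit (jacobian φ u).transpose.det := by rwa [Matrix.det_transpose]
  -- Symmetry of the second derivatives swaps the indices, which turns the double sum into the trace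
  -- of a matrix product.
  have key : ∀ (Φ : Euc n → Euc k) (x : Euc n), ContDiffAt ℝ ∞ Φ x →
      posMeanCurvature Φ x = ((paramMetric Φ x)⁻¹ *
        Matrix.of fun i j => ⟪pderiv₂ Φ x i j, Φ x - posTangent Φ x⟫_ℝ).trace := by
    intro Φ x hΦ
    simp only [posMeanCurvature, Matrix.trace, Matrix.diag, Matrix.mul_apply, Matrix.of_apply]
    refine Finset.sum_congr rfl fun i _ => Finset.sum_congr rfl fun j _ => ?_
    rw [pderiv₂_symm hΦ]
  have hN : F' u - posTangent F' u = F (φ u) - posTangent F (φ u) := by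
    rw [posTangent_comp hF hφ h hinj, h.self_of_nhds, Function.comp_apply]
  rw [key F' u ((hF.comp u hφ).congr_of_eventuallyEq h), key F _ hF, hN,
    inner_pderiv₂_comp hF hφ h
      (inner_fderiv_posNormal (injective_fderiv_of_comp hF hφ h hinj)),
    inv_paramMetric_comp hF hφ h, Matrix.transpose_nonsing_inv]
  set J := jacobian φ u
  set b := Matrix.of fun i j => ⟪pderiv₂ F (φ u) i j, F (φ u) - posTangent F (φ u)⟫_ℝ
  rw [show J⁻¹ * ((paramMetric F (φ u))⁻¹ * J.transpose⁻¹) * (J.transpose * b * J) =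
      J⁻¹ * ((paramMetric F (φ u))⁻¹ * (J.transpose⁻¹ * J.transpose) * b * J) by
        simp only [mul_assoc], Matrix.nonsing_inv_mul _ hJ', mul_one, Matrix.trace_mul_comm,
      mul_assoc, Matrix.mul_nonsing_inv _ hJ, mul_one]

end Param

/-! ### Chart independence and the shrinker equation on the manifold -/

section Manifold

variable {n k : ℕ} {M : Type*} [TopologicalSpace M] [ChartedSpace (Euc n) M] {X : M → Euc k}
  {p : M} {e : OpenPartialHomeomorph M (Euc n)}

theorem injective_fderiv_localParam_chartAt (hX : IsSmoothImmersion n X) (p : M) :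
    Function.Injective (fderiv ℝ (localParam X (chartAt (Euc n) p)) (chartAt (Euc n) p p)) := by
  have h := hX.injective_mfderiv p
  rw [(hX.contMDiff.mdifferentiableAt (by simp)).mfderiv] at h
  simp only [writtenInExtChartAt, extChartAt, mfld_simps, fderivWithin_univ] at h
  exact h

theorem contDiffOn_comp_symm [IsManifold (𝓡 n) ∞ M]
    {E : Type*} [NormedAddCommGroup E] [NormedSpace ℝ E] {f : M → E}
    (hf : ContMDiff (𝓡 n) 𝓘(ℝ, E) ∞ f) (he : e ∈ atlas (Euc n) M) :
    ContDiffOn ℝ ∞ (f ∘ e.symm) e.target := by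
  rw [← contMDiffOn_iff_contDiffOn]
  exact hf.comp_contMDiffOn
    (contMDiffOn_symm_of_mem_maximalAtlas (IsManifold.subset_maximalAtlas he))

theorem contDiffAt_transition [IsManifold (𝓡 n) ∞ M]
    (he : e ∈ atlas (Euc n) M) (hp : p ∈ e.source) :
    ContDiffAt ℝ ∞ (e ∘ (chartAt (Euc n) p).symm) (chartAt (Euc n) p p) := by
  have h := contDiffOn_transition he (chart_mem_atlas (Euc n) p)
  refine h.contDiffAt (((chartAt (Euc n) p).symm.trans e).open_source.mem_nhds ?_)
  simp [hp]

theorem comp_symm_eventuallyEq {E : Type*} (f : M → E) (hp : p ∈ e.source) :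
    f ∘ (chartAt (Euc n) p).symm =ᶠ[nhds (chartAt (Euc n) p p)]
      (f ∘ e.symm) ∘ (e ∘ (chartAt (Euc n) p).symm) := by
  have : chartAt (Euc n) p p ∈ ((chartAt (Euc n) p).symm.trans e).source := by simp [hp]
  filter_upwards [((chartAt (Euc n) p).symm.trans e).open_source.mem_nhds this] with u hu
  exact congrArg f (e.left_inv hu.2).symm

theorem contDiffAt_localParam [IsManifold (𝓡 n) ∞ M]
    (hX : IsSmoothImmersion n X) (he : e ∈ atlas (Euc n) M)
    (hp : p ∈ e.source) :
    ContDiffAt ℝ ∞ (localParam X e) ((e ∘ (chartAt (Euc n) p).symm) (chartAt (Euc n) p p)) :=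
  (contDiffOn_localParam hX.contMDiff he).contDiffAt
    (e.open_target.mem_nhds (by simpa using e.map_source hp))

/-- The immersion hypothesis speaks of the preferred chart at each point; the transition map carries
injectivity to every other chart. -/
theorem injective_fderiv_localParam [IsManifold (𝓡 n) ∞ M]
    (hX : IsSmoothImmersion n X) (he : e ∈ atlas (Euc n) M) :
    ∀ u ∈ e.target, Function.Injective (fderiv ℝ (localParam X e) u) := fun u hu => by
  have hp := e.map_target hu
  have h := injective_fderiv_of_comp (contDiffAt_localParam hX he hp)
    (contDiffAt_transition he hp) (comp_symm_eventuallyEq X hp)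
    (injective_fderiv_localParam_chartAt hX _)
  simpa [e.right_inv hu] using h

variable (n) in
/-- The squared length of the tangential part of the position vector. -/
def tangentSq (X : M → Euc k) (p : M) : ℝ :=
  posTangentSq (localParam X (chartAt (Euc n) p)) (chartAt (Euc n) p p)

variable (n) in
/-- The derivative of `f` in the direction of the tangential part of the position vector. -/
def tangentDeriv (X : M → Euc k) (f : M → ℝ) (p : M) : ℝ :=
  posDeriv (localParam X (chartAt (Euc n) p)) (f ∘ (chartAt (Euc n) p).symm) (chartAt (Euc n) p p)

variable (n) in
/-- The divergence of `f` times the position vector of a self-shrinker, with its normal part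
integrated away: `f (n - |X^N|² / 2) + ⟨∇f, X⟩`. -/
def weightedDiv (X : M → Euc k) (f : M → ℝ) (p : M) : ℝ :=
  f p * (n - (‖X p‖ ^ 2 - tangentSq n X p) / 2) + tangentDeriv n X f p

theorem tangentSq_eq [IsManifold (𝓡 n) ∞ M]
    (hX : IsSmoothImmersion n X) (he : e ∈ atlas (Euc n) M) (hp : p ∈ e.source) :
    tangentSq n X p = posTangentSq (localParam X e) (e p) := by
  have h := posTangentSq_comp (contDiffAt_localParam hX he hp)
    (contDiffAt_transition he hp) (comp_symm_eventuallyEq X hp)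
    (injective_fderiv_localParam_chartAt hX _)
  simp only [Function.comp_apply, OpenPartialHomeomorph.left_inv _ (mem_chart_source (Euc n) p)]
    at h
  exact h

theorem tangentDeriv_eq [IsManifold (𝓡 n) ∞ M]
    (hX : IsSmoothImmersion n X) (he : e ∈ atlas (Euc n) M)
    (hp : p ∈ e.source) {f : M → ℝ} (hf : ContMDiff (𝓡 n) 𝓘(ℝ, ℝ) ∞ f) :
    tangentDeriv n X f p = posDeriv (localParam X e) (f ∘ e.symm) (e p) := by
  have hfd : DifferentiableAt ℝ (f ∘ e.symm)
      ((e ∘ (chartAt (Euc n) p).symm) (chartAt (Euc n) p p)) :=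
    ((contDiffOn_comp_symm hf he).contDiffAt
      (e.open_target.mem_nhds (by simpa using e.map_source hp))).differentiableAt (by simp)
  have h := posDeriv_comp (contDiffAt_localParam hX he hp)
    (contDiffAt_transition he hp) (comp_symm_eventuallyEq X hp)
    (injective_fderiv_localParam_chartAt hX _) hfd (comp_symm_eventuallyEq f hp)
  simp only [Function.comp_apply, OpenPartialHomeomorph.left_inv _ (mem_chart_source (Euc n) p)]
    at h
  exact h

/-- The normal projection is self-adjoint, so it moves from the second derivatives onto the position
vector. -/
theorem inner_meanCurvature (hX : IsSmoothImmersion n X) (p : M) :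
    ⟪meanCurvature n X p, X p⟫_ℝ =
      posMeanCurvature (localParam X (chartAt (Euc n) p)) (chartAt (Euc n) p p) := by
  have hXp : localParam X (chartAt (Euc n) p) (chartAt (Euc n) p p) = X p := by simp [localParam]
  have hN := starProjection_orthogonal_range (injective_fderiv_localParam_chartAt hX p)
  simp only [meanCurvature, sum_inner, inner_smul_left, posMeanCurvature, conj_trivial,
    secondFundamentalForm, normalPart]
  refine Finset.sum_congr rfl fun i _ => Finset.sum_congr rfl fun j _ => ?_
  rw [Submodule.inner_starProjection_left_eq_right, ← hN, hXp]
  rfl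

theorem inner_normalPart (hX : IsSmoothImmersion n X) (p : M) :
    ⟪normalPart n X p (X p), X p⟫_ℝ = ‖X p‖ ^ 2 - tangentSq n X p := by
  have hXp : localParam X (chartAt (Euc n) p) (chartAt (Euc n) p p) = X p := by simp [localParam]
  have hN := starProjection_orthogonal_range (injective_fderiv_localParam_chartAt hX p)
  rw [hXp] at hN
  have hN2 : normalPart n X p (X p) = X p -
      posTangent (localParam X (chartAt (Euc n) p)) (chartAt (Euc n) p p) := hN
  rw [hN2, inner_sub_left, real_inner_self_eq_norm_sq, tangentSq, posTangentSq_eq_inner, hXp]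

theorem posMeanCurvature_of_isSelfShrinker [IsManifold (𝓡 n) ∞ M]
    (hX : IsSmoothImmersion n X)
    (hs : IsSelfShrinker n X) (he : e ∈ atlas (Euc n) M) (hp : p ∈ e.source) :
    posMeanCurvature (localParam X e) (e p) = -(‖X p‖ ^ 2 - tangentSq n X p) / 2 := by
  have h := posMeanCurvature_comp (contDiffAt_localParam hX he hp)
    (contDiffAt_transition he hp) (comp_symm_eventuallyEq X hp)
    (injective_fderiv_localParam_chartAt hX _)
  have h2 := inner_meanCurvature hX p
  rw [hs p, inner_smul_left, inner_normalPart hX] at h2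
  simp only [Function.comp_apply, OpenPartialHomeomorph.left_inv _ (mem_chart_source (Euc n) p)]
    at h
  rw [← h]
  refine h2.symm.trans ?_
  simp
  ring

theorem tangentSq_nonneg (hX : IsSmoothImmersion n X) (p : M) : 0 ≤ tangentSq n X p := by
  rw [tangentSq, posTangentSq_eq_norm_sq (injective_fderiv_localParam_chartAt hX p)]
  positivity

theorem tangentSq_le (hX : IsSmoothImmersion n X) (p : M) : tangentSq n X p ≤ ‖X p‖ ^ 2 := by
  have h := norm_posNormal_sq (injective_fderiv_localParam_chartAt hX p)
  have hXp : localParam X (chartAt (Euc n) p) (chartAt (Euc n) p p) = X p := by simp [localParam]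
  rw [hXp] at h
  have h2 := sq_nonneg ‖X p - posTangent (localParam X (chartAt (Euc n) p)) (chartAt (Euc n) p p)‖
  rw [h] at h2
  exact sub_nonneg.1 h2

/-- Quantities defined through the preferred chart at `p` use a chart that jumps with `p`, so their
continuity is read off from a formula valid throughout a fixed chart. -/
theorem continuous_of_forall_chart {h : M → ℝ} (H : (e : OpenPartialHomeomorph M (Euc n)) →
    Euc n → ℝ) (hH : ∀ e ∈ atlas (Euc n) M, ContinuousOn (H e) e.target)
    (hh : ∀ e ∈ atlas (Euc n) M, ∀ p ∈ e.source, h p = H e (e p)) : Continuous h := by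
  refine continuous_iff_continuousAt.2 fun p => ?_
  have hc := chart_mem_atlas (Euc n) p
  have h1 : ContinuousOn h (chartAt (Euc n) p).source :=
    ((hH _ hc).comp (chartAt (Euc n) p).continuousOn (chartAt (Euc n) p).mapsTo).congr
      fun q hq => hh _ hc q hq
  exact h1.continuousAt ((chartAt (Euc n) p).open_source.mem_nhds (mem_chart_source _ p))

theorem continuous_tangentSq [IsManifold (𝓡 n) ∞ M]
    (hX : IsSmoothImmersion n X) : Continuous (tangentSq n X) :=
  continuous_of_forall_chart (fun e => posTangentSq (localParam X e))
    (fun e he => (contDiffOn_posTangentSq e.open_target (contDiffOn_localParam hX.contMDiff he)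
      (injective_fderiv_localParam hX he)).continuousOn)
    fun _ he _ hp => tangentSq_eq hX he hp

theorem continuous_tangentDeriv [IsManifold (𝓡 n) ∞ M]
    (hX : IsSmoothImmersion n X) {f : M → ℝ}
    (hf : ContMDiff (𝓡 n) 𝓘(ℝ, ℝ) ∞ f) : Continuous (tangentDeriv n X f) := by
  refine continuous_of_forall_chart (fun e => posDeriv (localParam X e) (f ∘ e.symm))
    (fun e he => ?_) fun _ he _ hp => tangentDeriv_eq hX he hp hf
  simp only [funext (posDeriv_eq_sum _ _)]
  refine continuousOn_finsetSum _ fun i _ => ContinuousOn.mul ?_ ?_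
  · exact (contDiffOn_posCoord e.open_target (contDiffOn_localParam hX.contMDiff he)
      (injective_fderiv_localParam hX he) i).continuousOn
  · exact ((contDiffOn_comp_symm hf he).continuousOn_fderiv_of_isOpen e.open_target
      (by simp)).clm_apply continuousOn_const

theorem continuous_weightedDiv [IsManifold (𝓡 n) ∞ M]
    (hX : IsSmoothImmersion n X) {f : M → ℝ}
    (hf : ContMDiff (𝓡 n) 𝓘(ℝ, ℝ) ∞ f) : Continuous (weightedDiv n X f) :=
  (hf.continuous.mul (continuous_const.sub
    (((hX.contMDiff.continuous.norm.pow 2).sub (continuous_tangentSq hX)).div_const 2))).add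
    (continuous_tangentDeriv hX hf)

theorem weightedDiv_eq_zero_of_notMem_tsupport {f : M → ℝ} (hp : p ∉ tsupport f) :
    weightedDiv n X f p = 0 := by
  have h1 : f =ᶠ[nhds p] 0 := notMem_tsupport_iff_eventuallyEq.1 hp
  have h2 : f ∘ (chartAt (Euc n) p).symm =ᶠ[nhds (chartAt (Euc n) p p)] fun _ => 0 := by
    have := ((chartAt (Euc n) p).continuousAt_symm (mem_chart_target (Euc n) p))
    rw [ContinuousAt, (chartAt (Euc n) p).left_inv (mem_chart_source _ p)] at this
    exact this.eventually h1
  rw [weightedDiv, h1.self_of_nhds, tangentDeriv, posDeriv, h2.fderiv_eq]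
  simp

theorem weightedDiv_sum [IsManifold (𝓡 n) ∞ M]
    {ι : Type*} (s : Finset ι) {f : ι → M → ℝ}
    (hf : ∀ i, ContMDiff (𝓡 n) 𝓘(ℝ, ℝ) ∞ (f i)) (p : M) :
    weightedDiv n X (fun q => ∑ i ∈ s, f i q) p = ∑ i ∈ s, weightedDiv n X (f i) p := by
  simp only [weightedDiv, Finset.sum_add_distrib, ← Finset.sum_mul]
  congr 1
  have hc := chart_mem_atlas (Euc n) p
  have hd : ∀ i ∈ s, DifferentiableAt ℝ (f i ∘ (chartAt (Euc n) p).symm) (chartAt (Euc n) p p) :=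
    fun i _ => ((contDiffOn_comp_symm (hf i) hc).contDiffAt
      ((chartAt (Euc n) p).open_target.mem_nhds (mem_chart_target _ p))).differentiableAt (by simp)
  have h := fderiv_fun_sum hd
  simp only [tangentDeriv, posDeriv]
  rw [← sum_apply, ← h]
  rfl

theorem continuousOn_sqrt_det_inducedMetric [IsManifold (𝓡 n) ∞ M]
    (hX : IsSmoothImmersion n X)
    (he : e ∈ atlas (Euc n) M) :
    ContinuousOn (fun u => √(inducedMetric X e u).det) e.target :=
  (contDiffOn_sqrt_det_paramMetric e.open_target (contDiffOn_localParam hX.contMDiff he)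
    (injective_fderiv_localParam hX he)).continuousOn

/-- The chain rule, together with `⟨∇|X|², X^T⟩ = 2|X^T|²`. -/
theorem tangentDeriv_comp_norm_sq [IsManifold (𝓡 n) ∞ M]
    (hX : IsSmoothImmersion n X) {η : ℝ → ℝ}
    (hη : ContDiff ℝ ∞ η) (p : M) :
    tangentDeriv n X (fun q => η (‖X q‖ ^ 2)) p =
      2 * deriv η (‖X p‖ ^ 2) * tangentSq n X p := by
  set c := chartAt (Euc n) p
  have hXp : localParam X c (c p) = X p := by simp [localParam, c]
  have hF : HasFDerivAt (localParam X c) (fderiv ℝ (localParam X c) (c p)) (c p) :=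
    (((contDiffOn_localParam hX.contMDiff (chart_mem_atlas (Euc n) p)).contDiffAt
      (c.open_target.mem_nhds (mem_chart_target _ p))).differentiableAt (by simp)).hasFDerivAt
  have hd : HasDerivAt η (deriv η (‖X p‖ ^ 2)) (‖localParam X c (c p)‖ ^ 2) := by
    rw [hXp]
    exact ((hη.differentiable (by simp)) _).hasDerivAt
  have h := (hd.comp_hasFDerivAt (c p) hF.norm_sq).fderiv
  have h2 : tangentDeriv n X (fun q => η (‖X q‖ ^ 2)) p =
      fderiv ℝ (η ∘ fun u => ‖localParam X c u‖ ^ 2) (c p)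
        (WithLp.toLp 2 (posCoord (localParam X c) (c p))) := rfl
  rw [h2, h, tangentSq, posTangentSq_eq_inner, posTangent_eq_fderiv, real_inner_comm]
  simp [c]
  ring

end Manifold

/-! ### Integration against the induced volume and the first variation formula -/

section Integral

variable {n k : ℕ} {M : Type*} [TopologicalSpace M] [ChartedSpace (Euc n) M]
  [MeasurableSpace M] [BorelSpace M] {X : M → Euc k} {e : OpenPartialHomeomorph M (Euc n)}

variable [IsManifold (𝓡 n) ∞ M]

theorem integral_inducedVolume_of_support (hX : IsSmoothImmersion n X)
    (he : e ∈ atlas (Euc n) M) {h : M → ℝ} (hc : Continuous h) (hs : ∀ p ∉ e.source, h p = 0) :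
    ∫ p, h p ∂inducedVolume n X = ∫ u in e.target, √(inducedMetric X e u).det * h (e.symm u) := by
  have hm : AEMeasurable e.symm ((volume : Measure (Euc n)).restrict e.target) :=
    e.continuousOn_symm.aemeasurable e.open_target.measurableSet
  have hd : AEMeasurable (fun u => ENNReal.ofReal √(inducedMetric X e u).det)
      ((volume : Measure (Euc n)).restrict e.target) :=
    ((continuousOn_sqrt_det_inducedMetric hX he).aemeasurable
      e.open_target.measurableSet).ennreal_ofReal
  rw [← setIntegral_eq_integral_of_forall_compl_eq_zero hs,
    inducedVolume_restrict_source hX.contMDiff he, chartVolume,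
    integral_map (hm.mono_ac (withDensity_absolutelyContinuous _ _)) hc.aestronglyMeasurable,
    integral_withDensity_eq_integral_toReal_smul₀ hd (by simp)]
  simp

theorem chartVolume_lt_top (hX : IsSmoothImmersion n X) (he : e ∈ atlas (Euc n) M)
    {K : Set (Euc n)} (hK : IsCompact K) (hKe : K ⊆ e.target) {A : Set M} (hA : MeasurableSet A)
    (hAK : e.target ∩ e.symm ⁻¹' A ⊆ K) : chartVolume X e A < ⊤ := by
  rw [chartVolume_apply X e hA]
  refine (lintegral_mono_set hAK).trans_lt ?_
  exact (((continuousOn_sqrt_det_inducedMetric hX he).mono hKe).integrableOn_compact hK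
    ).setLIntegral_lt_top

/-- Near a point the measure is a continuous density over a compact coordinate ball. Local
finiteness makes continuous compactly supported functions integrable. -/
theorem isLocallyFiniteMeasure_inducedVolume (hX : IsSmoothImmersion n X) :
    IsLocallyFiniteMeasure (inducedVolume n X) := by
  refine ⟨fun p => ?_⟩
  have he := chart_mem_atlas (Euc n) p
  set e := chartAt (Euc n) p
  obtain ⟨ε, hε, hball⟩ := Metric.nhds_basis_closedBall.mem_iff.1
    (e.open_target.mem_nhds (mem_chart_target (Euc n) p))
  set A := e.source ∩ e ⁻¹' Metric.ball (e p) ε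
  have hAo : IsOpen A := e.continuousOn.isOpen_inter_preimage e.open_source Metric.isOpen_ball
  refine ⟨A, hAo.mem_nhds ⟨mem_chart_source _ p, Metric.mem_ball_self hε⟩, ?_⟩
  have h1 : inducedVolume n X A = chartVolume X e A := by
    rw [← inducedVolume_restrict_source hX.contMDiff he, Measure.restrict_apply hAo.measurableSet,
      Set.inter_eq_left.2 Set.inter_subset_left]
  rw [h1]
  refine chartVolume_lt_top hX he (isCompact_closedBall (e p) ε) hball hAo.measurableSet ?_
  rintro u ⟨hu, -, hu2⟩
  rw [Set.mem_preimage, e.right_inv hu] at hu2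
  exact Metric.ball_subset_closedBall hu2

theorem integral_weightedDiv_of_tsupport_subset (hX : IsSmoothImmersion n X)
    (hs : IsSelfShrinker n X) (he : e ∈ atlas (Euc n) M) {f : M → ℝ}
    (hf : ContMDiff (𝓡 n) 𝓘(ℝ, ℝ) ∞ f) (hc : HasCompactSupport f) (hfe : tsupport f ⊆ e.source) :
    ∫ p, weightedDiv n X f p ∂inducedVolume n X = 0 := by
  rw [integral_inducedVolume_of_support hX he (continuous_weightedDiv hX hf)
    fun p hp => weightedDiv_eq_zero_of_notMem_tsupport fun h => hp (hfe h)]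
  rw [← setIntegral_sqrt_det_mul_eq_zero e.open_target (contDiffOn_localParam hX.contMDiff he)
    (injective_fderiv_localParam hX he) (contDiffOn_comp_symm hf he)
    (hc.image_of_continuousOn (e.continuousOn.mono hfe))
    (Set.image_subset_iff.2 fun p hp => e.map_source (hfe hp))]
  · refine setIntegral_congr_fun e.open_target.measurableSet fun u hu => ?_
    have hp := e.map_target hu
    have h1 := posMeanCurvature_of_isSelfShrinker hX hs he hp
    have h2 := tangentDeriv_eq hX he hp hf
    rw [e.right_inv hu] at h1 h2
    simp only [weightedDiv, h1, h2, Function.comp_apply, sub_eq_add_neg, neg_div]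
    rfl
  · intro u hu huK
    refine image_eq_zero_of_notMem_tsupport (f := f) (x := e.symm u) fun h => huK ⟨_, h, e.right_inv hu⟩

theorem integrable_weightedDiv (hX : IsSmoothImmersion n X) [T2Space M] {f : M → ℝ}
    (hf : ContMDiff (𝓡 n) 𝓘(ℝ, ℝ) ∞ f) (hc : HasCompactSupport f) :
    Integrable (weightedDiv n X f) (inducedVolume n X) := by
  have := isLocallyFiniteMeasure_inducedVolume hX
  exact (continuous_weightedDiv hX hf).integrable_of_hasCompactSupport
    (HasCompactSupport.intro hc fun p hp => weightedDiv_eq_zero_of_notMem_tsupport hp)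

/-- The first variation formula for a self-shrinker, for the position vector times a compactly
supported function. -/
theorem integral_weightedDiv_eq_zero [T2Space M] [SigmaCompactSpace M]
    (hX : IsSmoothImmersion n X) (hs : IsSelfShrinker n X) {f : M → ℝ}
    (hf : ContMDiff (𝓡 n) 𝓘(ℝ, ℝ) ∞ f) (hc : HasCompactSupport f) :
    ∫ p, weightedDiv n X f p ∂inducedVolume n X = 0 := by
  -- A partition of unity subordinate to the chart domains reduces to functions supported in one
  -- chart. Only the finitely many members that meet the support of `f` matter, so `f` is a finite
  -- sum.
  obtain ⟨ρ, hρ⟩ := SmoothPartitionOfUnity.exists_isSubordinate_chartAt_source (𝓡 n) M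
  have hfin := ρ.locallyFinite.finite_nonempty_inter_compact hc
  set s := hfin.toFinset with hsdef
  have hρf : ∀ i, ContMDiff (𝓡 n) 𝓘(ℝ, ℝ) ∞ fun q => ρ i q * f q := fun i =>
    (ρ i).contMDiff.mul hf
  have hsum : f = fun q => ∑ i ∈ s, ρ i q * f q := by
    funext q
    rw [← Finset.sum_mul]
    by_cases hq : q ∈ tsupport f
    · rw [ρ.sum_finsupport' q (Set.mem_univ q), one_mul]
      intro i hi
      rw [hsdef, Set.Finite.mem_toFinset]
      exact ⟨q, (ρ.mem_finsupport q).1 hi, hq⟩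
    · rw [image_eq_zero_of_notMem_tsupport hq, mul_zero]
  have hci : ∀ i, HasCompactSupport fun q => ρ i q * f q := fun i => hc.mul_left
  rw [hsum, funext (weightedDiv_sum s hρf),
    integral_finsetSum _ fun i _ => integrable_weightedDiv hX (hρf i) (hci i)]
  refine Finset.sum_eq_zero fun i _ => ?_
  exact integral_weightedDiv_of_tsupport_subset hX hs (chart_mem_atlas (Euc n) i) (hρf i) (hci i)
    ((tsupport_mul_subset_left).trans (hρ i))

end Integral

/-! ### Gaussian area monotonicity and volume growth -/

section Growth

variable {n k : ℕ} {M : Type*} [TopologicalSpace M] {X : M → Euc k} {R : ℝ}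

theorem isCompact_preimage_closedBall (hp : IsProperMap X) (R : ℝ) :
    IsCompact (X ⁻¹' Metric.closedBall 0 R) :=
  hp.isCompact_preimage (isCompact_closedBall 0 R)

/-- Preimages of the balls of integer radius exhaust `M`. This supplies the countability needed for
partitions of unity. -/
theorem sigmaCompactSpace_of_isProperMap (hp : IsProperMap X) : SigmaCompactSpace M := by
  refine ⟨⟨fun j : ℕ => X ⁻¹' Metric.closedBall 0 j, fun j => isCompact_preimage_closedBall hp j,
    ?_⟩⟩
  rw [← Set.preimage_iUnion, Metric.iUnion_closedBall_nat, Set.preimage_univ]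

theorem hasCompactSupport_comp_norm_sq [T2Space M] (hp : IsProperMap X) (hR : 0 ≤ R) {η : ℝ → ℝ}
    (hη : ∀ s, R ^ 2 ≤ s → η s = 0) : HasCompactSupport fun p => η (‖X p‖ ^ 2) := by
  refine HasCompactSupport.intro (isCompact_preimage_closedBall hp R) fun p hpR => hη _ ?_
  simp only [Set.mem_preimage, Metric.mem_closedBall, dist_zero_right, not_le] at hpR
  exact pow_le_pow_left₀ hR hpR.le 2

variable [ChartedSpace (Euc n) M] [IsManifold (𝓡 n) ∞ M] [MeasurableSpace M] [BorelSpace M]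

theorem inducedVolume_preimage_ball_lt_top (hX : IsSmoothImmersion n X) (hp : IsProperMap X)
    (r : ℝ) : inducedVolume n X (X ⁻¹' Metric.ball 0 r) < ⊤ := by
  have := isLocallyFiniteMeasure_inducedVolume hX
  exact (measure_mono (Set.preimage_mono Metric.ball_subset_closedBall)).trans_lt
    (isCompact_preimage_closedBall hp r).measure_lt_top

variable [T2Space M]

theorem integrable_comp_norm_sq (hX : IsSmoothImmersion n X) (hp : IsProperMap X)
    (hR : 0 ≤ R) {η : ℝ → ℝ} (hc : Continuous η) (hη : ∀ s, R ^ 2 ≤ s → η s = 0) :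
    Integrable (fun p => η (‖X p‖ ^ 2)) (inducedVolume n X) := by
  have := isLocallyFiniteMeasure_inducedVolume hX
  exact (hc.comp (hX.contMDiff.continuous.norm.pow 2)).integrable_of_hasCompactSupport
    (hasCompactSupport_comp_norm_sq hp hR hη)

variable {φ : ℝ → ℝ}

/-- Gaussian densities at scales at least that of the self-shrinker have nonnegative divergence
against the position vector. -/
theorem integral_gaussian_mul_nonneg (hX : IsSmoothImmersion n X) (hp : IsProperMap X)
    (hs : IsSelfShrinker n X) (hφ : ContDiff ℝ ∞ φ) (hφ0 : ∀ s, 0 ≤ φ s) (hφm : Antitone φ)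
    (hR : 0 ≤ R) (hφR : ∀ s, R ^ 2 ≤ s → φ s = 0) {b : ℝ} (hb0 : 0 ≤ b) (hb1 : b ≤ 1) :
    0 ≤ ∫ p, φ (‖X p‖ ^ 2) * Real.exp (-(b ^ 2 / 4) * ‖X p‖ ^ 2) *
      (n - b ^ 2 / 2 * ‖X p‖ ^ 2) ∂inducedVolume n X := by
  have := sigmaCompactSpace_of_isProperMap hp
  set η : ℝ → ℝ := fun s => φ s * Real.exp (-(b ^ 2 / 4) * s) with hηdef
  have hη : ContDiff ℝ ∞ η := by fun_prop
  have hηR : ∀ s, R ^ 2 ≤ s → η s = 0 := fun s h => by simp [hηdef, hφR s h]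
  have hf : ContMDiff (𝓡 n) 𝓘(ℝ, ℝ) ∞ fun p => η (‖X p‖ ^ 2) :=
    (hη.comp (contDiff_norm_sq ℝ)).contMDiff.comp hX.contMDiff
  have hfc := hasCompactSupport_comp_norm_sq hp hR hηR
  rw [← integral_weightedDiv_eq_zero hX hs hf hfc]
  -- The inequality holds pointwise: the divergence, whose integral is zero, is bounded above by the
  -- claimed integrand.
  refine integral_mono (integrable_weightedDiv hX hf hfc)
    (integrable_comp_norm_sq hX hp hR (η := fun s => φ s * Real.exp (-(b ^ 2 / 4) * s) *
      (n - b ^ 2 / 2 * s)) (by have := hφ.continuous; fun_prop)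
      fun s h => by simp [hφR s h]) fun p => ?_
  have hτ0 := tangentSq_nonneg hX p
  have hτ1 := tangentSq_le hX p
  have hd : deriv η (‖X p‖ ^ 2) = deriv φ (‖X p‖ ^ 2) * Real.exp (-(b ^ 2 / 4) * ‖X p‖ ^ 2) +
      η (‖X p‖ ^ 2) * -(b ^ 2 / 4) := by
    have h1 := ((hφ.differentiable (by simp)) (‖X p‖ ^ 2)).hasDerivAt
    have h2 := ((hasDerivAt_id (‖X p‖ ^ 2)).const_mul (-(b ^ 2 / 4))).exp
    refine (h1.mul h2).deriv.trans ?_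
    simp [hηdef]
    ring
  have hφ' : deriv φ (‖X p‖ ^ 2) ≤ 0 := hφm.deriv_nonpos
  have hη0 : 0 ≤ η (‖X p‖ ^ 2) := mul_nonneg (hφ0 _) (Real.exp_pos _).le
  have hb : b ^ 2 ≤ 1 := pow_le_one₀ hb0 hb1
  simp only [weightedDiv]
  rw [tangentDeriv_comp_norm_sq hX hη, hd]
  change _ ≤ η (‖X p‖ ^ 2) * _
  -- The two discarded terms: the cut-off contributes `2φ'|X^T|²` times the Gaussian, which is
  -- nonpositive, and replacing `|X^N|²` by `b²|X^N|²` costs `η (1 - b²)|X^N|²/2 ≥ 0`.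
  have e1 : deriv φ (‖X p‖ ^ 2) * Real.exp (-(b ^ 2 / 4) * ‖X p‖ ^ 2) * tangentSq n X p ≤ 0 :=
    mul_nonpos_of_nonpos_of_nonneg (mul_nonpos_of_nonpos_of_nonneg hφ' (Real.exp_pos _).le) hτ0
  have e2 : 0 ≤ η (‖X p‖ ^ 2) * ((1 - b ^ 2) * (‖X p‖ ^ 2 - tangentSq n X p)) :=
    mul_nonneg hη0 (mul_nonneg (sub_nonneg.2 hb) (sub_nonneg.2 hτ1))
  linarith

/-- The derivative of the Gaussian area with respect to the inverse scale. -/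
theorem hasDerivAt_integral_gaussian (hX : IsSmoothImmersion n X) (hp : IsProperMap X)
    (hφ : Continuous φ) (hφ0 : ∀ s, 0 ≤ φ s) (hR : 0 ≤ R) (hφR : ∀ s, R ^ 2 ≤ s → φ s = 0)
    {b : ℝ} (hb0 : 0 ≤ b) (hb1 : b ≤ 1) :
    HasDerivAt (fun b => ∫ p, φ (‖X p‖ ^ 2) * Real.exp (-(b ^ 2 / 4) * ‖X p‖ ^ 2)
        ∂inducedVolume n X)
      (∫ p, φ (‖X p‖ ^ 2) * (Real.exp (-(b ^ 2 / 4) * ‖X p‖ ^ 2) * (-(b / 2) * ‖X p‖ ^ 2))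
        ∂inducedVolume n X) b := by
  have hint : ∀ η : ℝ → ℝ, Continuous η →
      Integrable (fun p => φ (‖X p‖ ^ 2) * η (‖X p‖ ^ 2)) (inducedVolume n X) := fun η hη =>
    integrable_comp_norm_sq hX hp hR (η := fun s => φ s * η s) (hφ.mul hη)
      fun s h => by simp [hφR s h]
  -- On the unit ball about `b ≤ 1` one has `|c/2| ≤ 1` and the exponential is at most `1`, so `φ
  -- |X|²` dominates the derivative; it is integrable because `φ` is cut off.
  refine (hasDerivAt_integral_of_dominated_loc_of_deriv_le (s := Metric.ball b 1)
    (bound := fun p => φ (‖X p‖ ^ 2) * ‖X p‖ ^ 2)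
    (F' := fun b p => φ (‖X p‖ ^ 2) *
      (Real.exp (-(b ^ 2 / 4) * ‖X p‖ ^ 2) * (-(b / 2) * ‖X p‖ ^ 2)))
    (Metric.ball_mem_nhds b one_pos) (Filter.Eventually.of_forall fun c => ?_) ?_ ?_ ?_ ?_ ?_).2
  · exact (hint (fun s => Real.exp (-(c ^ 2 / 4) * s)) (by fun_prop)).aestronglyMeasurable
  · exact hint (fun s => Real.exp (-(b ^ 2 / 4) * s)) (by fun_prop)
  · exact (hint (fun s => Real.exp (-(b ^ 2 / 4) * s) * (-(b / 2) * s))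
      (by fun_prop)).aestronglyMeasurable
  · refine Filter.Eventually.of_forall fun p c hc => ?_
    have hc2 : |c / 2| ≤ 1 := by
      rw [Metric.mem_ball, Real.dist_eq, abs_lt] at hc
      rw [abs_le]
      constructor <;> linarith
    have hexp : Real.exp (-(c ^ 2 / 4) * ‖X p‖ ^ 2) ≤ 1 := by
      rw [Real.exp_le_one_iff, neg_mul]
      exact neg_nonpos.2 (by positivity)
    rw [norm_mul, norm_mul, norm_mul, Real.norm_of_nonneg (hφ0 _),
      Real.norm_of_nonneg (Real.exp_pos _).le, Real.norm_of_nonneg (sq_nonneg ‖X p‖), norm_neg,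
      Real.norm_eq_abs]
    refine mul_le_mul_of_nonneg_left ?_ (hφ0 _)
    calc _ ≤ 1 * (1 * ‖X p‖ ^ 2) := by gcongr
      _ = _ := by ring
  · exact hint (fun s => s) continuous_id
  · refine Filter.Eventually.of_forall fun p c _ => ?_
    have h1 : HasDerivAt (fun c : ℝ => -(c ^ 2 / 4) * ‖X p‖ ^ 2) (-(c / 2) * ‖X p‖ ^ 2) c := by
      refine ((((hasDerivAt_pow 2 c).div_const 4).neg).mul_const _).congr_deriv ?_
      push_cast
      ring
    exact h1.exp.const_mul _

/-- The normalized Gaussian area of a self-shrinker is monotone in the inverse scale. -/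
theorem gaussian_area_le (hn : 1 ≤ n) (hX : IsSmoothImmersion n X) (hp : IsProperMap X)
    (hs : IsSelfShrinker n X) (hφ : ContDiff ℝ ∞ φ) (hφ0 : ∀ s, 0 ≤ φ s) (hφm : Antitone φ)
    (hR : 0 ≤ R) (hφR : ∀ s, R ^ 2 ≤ s → φ s = 0) {b : ℝ} (hb0 : 0 < b) (hb1 : b ≤ 1) :
    b ^ n * ∫ p, φ (‖X p‖ ^ 2) * Real.exp (-(b ^ 2 / 4) * ‖X p‖ ^ 2) ∂inducedVolume n X ≤
      ∫ p, φ (‖X p‖ ^ 2) * Real.exp (-(1 / 4) * ‖X p‖ ^ 2) ∂inducedVolume n X := by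
  set G : ℝ → ℝ := fun b => b ^ n *
    ∫ p, φ (‖X p‖ ^ 2) * Real.exp (-(b ^ 2 / 4) * ‖X p‖ ^ 2) ∂inducedVolume n X with hG
  have hderiv : ∀ c ∈ Set.Icc b 1, ∃ d, 0 ≤ d ∧ HasDerivAt G d c := by
    intro c hc
    have hc0 : 0 < c := hb0.trans_le hc.1
    have h1 := (hasDerivAt_pow n c).mul
      (hasDerivAt_integral_gaussian hX hp hφ.continuous hφ0 hR hφR hc0.le hc.2)
    have h2 := integral_gaussian_mul_nonneg hX hp hs hφ hφ0 hφm hR hφR hc0.le hc.2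
    refine ⟨_, ?_, h1⟩
    have hint : ∀ η : ℝ → ℝ, Continuous η →
        Integrable (fun p => φ (‖X p‖ ^ 2) * η (‖X p‖ ^ 2)) (inducedVolume n X) := fun η hη =>
      integrable_comp_norm_sq hX hp hR (η := fun s => φ s * η s) (hφ.continuous.mul hη)
        fun s h => by simp [hφR s h]
    -- Writing `n = m + 1` removes the truncated subtraction in the derivative of `b^n`, so that
    -- `c^m` factors out of the whole derivative.
    rcases n with - | m
    · exact absurd hn (by norm_num)
    rw [← integral_const_mul, ← integral_const_mul, ← integral_add]
    · refine (mul_nonneg (pow_nonneg hc0.le m) h2).trans_eq ?_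
      rw [← integral_const_mul]
      congr 1
      funext p
      simp only [Nat.add_sub_cancel]
      push_cast
      ring
    · exact (hint (fun s => Real.exp (-(c ^ 2 / 4) * s)) (by fun_prop)).const_mul _
    · exact (hint (fun s => Real.exp (-(c ^ 2 / 4) * s) * (-(c / 2) * s)) (by fun_prop)).const_mul _
  have hmono : MonotoneOn G (Set.Icc b 1) := by
    refine monotoneOn_of_deriv_nonneg (convex_Icc b 1) (fun c hc => ?_) (fun c hc => ?_)
      fun c hc => ?_
    · obtain ⟨d, -, h⟩ := hderiv c hc
      exact h.continuousAt.continuousWithinAt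
    · obtain ⟨d, -, h⟩ := hderiv c (interior_subset hc)
      exact h.differentiableAt.differentiableWithinAt
    · obtain ⟨d, hd, h⟩ := hderiv c (interior_subset hc)
      rwa [h.deriv]
  have h := hmono (Set.left_mem_Icc.2 hb1) (Set.right_mem_Icc.2 hb1) hb1
  simpa [hG] using h

/-- The factor of the absorption argument: `12n² = (1/4 - 1/16)(8n)²` is the Gaussian gain outside
`D_{8n}` and `2^n` the loss from the scale `b = 1/2`. The bound follows from `2^(n+1) ≤ e^(n+1) ≤
e^(12n²)`. -/
theorem exp_neg_mul_two_pow_le (hn : 1 ≤ n) : Real.exp (-(12 * (n : ℝ) ^ 2)) * 2 ^ n ≤ 1 / 2 := by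
  have hn' : (1 : ℝ) ≤ n := by exact_mod_cast hn
  have h2 : (2 : ℝ) ≤ Real.exp 1 := by linarith [Real.add_one_le_exp (1 : ℝ)]
  have h3 : (2 : ℝ) ^ (n + 1) ≤ Real.exp (12 * (n : ℝ) ^ 2) := by
    calc (2 : ℝ) ^ (n + 1) ≤ Real.exp 1 ^ (n + 1) := by gcongr
      _ = Real.exp (n + 1) := by rw [← Real.exp_nat_mul]; simp
      _ ≤ Real.exp (12 * (n : ℝ) ^ 2) := Real.exp_le_exp.2 (by nlinarith)
  rw [Real.exp_neg, inv_mul_le_iff₀ (Real.exp_pos _)]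
  rw [pow_succ] at h3
  linarith

/-- Absorption: inside `D_{8n}` the integrand is at most `1`; outside, it is compared with the scale
`b = 1/2`, and monotonicity bounds that contribution by half of the left side. -/
theorem integral_gaussian_le (hn : 1 ≤ n) (hX : IsSmoothImmersion n X) (hp : IsProperMap X)
    (hs : IsSelfShrinker n X) (hφ : ContDiff ℝ ∞ φ) (hφ0 : ∀ s, 0 ≤ φ s) (hφ1 : ∀ s, φ s ≤ 1)
    (hφm : Antitone φ) (hR : 0 ≤ R) (hφR : ∀ s, R ^ 2 ≤ s → φ s = 0) :
    ∫ p, φ (‖X p‖ ^ 2) * Real.exp (-(1 / 4) * ‖X p‖ ^ 2) ∂inducedVolume n X ≤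
      2 * (inducedVolume n X).real (X ⁻¹' Metric.ball 0 (8 * n)) := by
  set D := X ⁻¹' Metric.ball (0 : Euc k) (8 * n) with hD
  have hDm : MeasurableSet D := (Metric.isOpen_ball.preimage hX.contMDiff.continuous).measurableSet
  have hgauss : ∀ a : ℝ, Integrable (fun p => φ (‖X p‖ ^ 2) * Real.exp (-a * ‖X p‖ ^ 2))
      (inducedVolume n X) := fun a =>
    integrable_comp_norm_sq hX hp hR (η := fun s => φ s * Real.exp (-a * s))
      (by have := hφ.continuous; fun_prop) fun s h => by simp [hφR s h]
  have hDi : Integrable (D.indicator (1 : M → ℝ)) (inducedVolume n X) :=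
    (integrable_indicator_iff hDm).2
      (integrableOn_const (inducedVolume_preimage_ball_lt_top hX hp _).ne)
  set J := ∫ p, φ (‖X p‖ ^ 2) * Real.exp (-(1 / 4) * ‖X p‖ ^ 2) ∂inducedVolume n X with hJ
  have hJ0 : 0 ≤ J := integral_nonneg fun p => mul_nonneg (hφ0 _) (Real.exp_pos _).le
  have h1 : J ≤ (inducedVolume n X).real D + Real.exp (-(12 * (n : ℝ) ^ 2)) *
      ∫ p, φ (‖X p‖ ^ 2) * Real.exp (-((1 / 2) ^ 2 / 4) * ‖X p‖ ^ 2) ∂inducedVolume n X := by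
    rw [← integral_indicator_one hDm, ← integral_const_mul, ← integral_add hDi
      ((hgauss _).const_mul _)]
    refine integral_mono (hgauss _) (hDi.add ((hgauss _).const_mul _)) fun p => ?_
    simp only
    by_cases hpD : p ∈ D
    · rw [Set.indicator_of_mem hpD, Pi.one_apply]
      have e1 : φ (‖X p‖ ^ 2) * Real.exp (-(1 / 4) * ‖X p‖ ^ 2) ≤ 1 * 1 := by
        refine mul_le_mul (hφ1 _) ?_ (Real.exp_pos _).le zero_le_one
        rw [Real.exp_le_one_iff, neg_mul]
        exact neg_nonpos.2 (by positivity)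
      have e2 : 0 ≤ Real.exp (-(12 * (n : ℝ) ^ 2)) *
          (φ (‖X p‖ ^ 2) * Real.exp (-((1 / 2) ^ 2 / 4) * ‖X p‖ ^ 2)) :=
        mul_nonneg (Real.exp_pos _).le (mul_nonneg (hφ0 _) (Real.exp_pos _).le)
      linarith
    -- Here `|X| ≥ 8n`, so `-|X|²/4 ≤ -12n² - |X|²/16`.
    · rw [Set.indicator_of_notMem hpD, zero_add, mul_left_comm, ← Real.exp_add]
      refine mul_le_mul_of_nonneg_left (Real.exp_le_exp.2 ?_) (hφ0 _)
      have h8 : (8 * (n : ℝ)) ^ 2 ≤ ‖X p‖ ^ 2 := by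
        refine pow_le_pow_left₀ (by positivity) ?_ 2
        simpa [hD] using hpD
      linarith
  have h2 := gaussian_area_le hn hX hp hs hφ hφ0 hφm hR hφR (b := 1 / 2) (by norm_num) (by norm_num)
  have h3 := mul_le_mul_of_nonneg_right (exp_neg_mul_two_pow_le hn) hJ0
  have h4 : Real.exp (-(12 * (n : ℝ) ^ 2)) * ∫ p, φ (‖X p‖ ^ 2) *
      Real.exp (-((1 / 2) ^ 2 / 4) * ‖X p‖ ^ 2) ∂inducedVolume n X ≤
      Real.exp (-(12 * (n : ℝ) ^ 2)) * 2 ^ n * J := by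
    rw [mul_assoc]
    refine mul_le_mul_of_nonneg_left ?_ (Real.exp_pos _).le
    rw [one_div, inv_pow, inv_mul_le_iff₀ (by positivity)] at h2
    simpa [hJ] using h2
  linarith

theorem real_inducedVolume_preimage_ball_le (hn : 1 ≤ n) (hX : IsSmoothImmersion n X)
    (hp : IsProperMap X) (hs : IsSelfShrinker n X) {r : ℝ} (hr : 1 ≤ r) :
    (inducedVolume n X).real (X ⁻¹' Metric.ball 0 r) ≤
      6 * (inducedVolume n X).real (X ⁻¹' Metric.ball 0 (8 * n)) * r ^ n := by
  -- As a function of `s = |X|²`, the cut-off equals `1` for `s ≤ r²` and `0` for `s ≥ r² + 1`, in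
  -- particular for `s ≥ (r + 1)²`.
  set φ : ℝ → ℝ := fun s => Real.smoothTransition (r ^ 2 + 1 - s) with hφdef
  have hφ : ContDiff ℝ ∞ φ := Real.smoothTransition.contDiff.comp (by fun_prop)
  have hφ0 : ∀ s, 0 ≤ φ s := fun s => Real.smoothTransition.nonneg _
  have hφm : Antitone φ := fun s t hst => Real.smoothTransition.monotone (by linarith)
  have hφR : ∀ s, (r + 1) ^ 2 ≤ s → φ s = 0 := fun s h =>
    Real.smoothTransition.zero_of_nonpos (by nlinarith)
  have hR : 0 ≤ r + 1 := by linarith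
  have hr0 : 0 < r := by linarith
  have h1 := integral_gaussian_le hn hX hp hs hφ hφ0 (fun s => Real.smoothTransition.le_one _)
    hφm hR hφR
  have h2 := gaussian_area_le hn hX hp hs hφ hφ0 hφm hR hφR (b := r⁻¹) (by positivity)
    (inv_le_one_of_one_le₀ hr)
  set D := X ⁻¹' Metric.ball (0 : Euc k) r with hD
  have hDm : MeasurableSet D := (Metric.isOpen_ball.preimage hX.contMDiff.continuous).measurableSet
  -- On `D_r` the exponent at `b = 1/r` is at least `-1/4`, so the weight is at least `3/4`, and the
  -- factor `3` is more than enough. With `J ≤ 2V` it makes the final constant `6`.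
  have h3 : (inducedVolume n X).real D ≤ 3 * ∫ p, φ (‖X p‖ ^ 2) *
      Real.exp (-(r⁻¹ ^ 2 / 4) * ‖X p‖ ^ 2) ∂inducedVolume n X := by
    rw [← integral_indicator_one hDm, ← integral_const_mul]
    refine integral_mono ((integrable_indicator_iff hDm).2
      (integrableOn_const (inducedVolume_preimage_ball_lt_top hX hp _).ne))
      ((integrable_comp_norm_sq hX hp hR (η := fun s => φ s * Real.exp (-(r⁻¹ ^ 2 / 4) * s))
        (by have := hφ.continuous; fun_prop) fun s h => by simp [hφR s h]).const_mul 3) fun p => ?_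
    simp only
    by_cases hpD : p ∈ D
    · rw [Set.indicator_of_mem hpD]
      have hXr : ‖X p‖ ^ 2 ≤ r ^ 2 :=
        pow_le_pow_left₀ (norm_nonneg _) (by simpa using (Metric.ball_subset_closedBall hpD)) 2
      have hφp : φ (‖X p‖ ^ 2) = 1 := Real.smoothTransition.one_of_one_le (by linarith)
      have hle : r⁻¹ ^ 2 * ‖X p‖ ^ 2 ≤ 1 := by
        rw [inv_pow, inv_mul_le_iff₀ (by positivity)]
        linarith
      have hexp : 1 - 1 / 4 ≤ Real.exp (-(r⁻¹ ^ 2 / 4) * ‖X p‖ ^ 2) := by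
        linarith [Real.add_one_le_exp (-(r⁻¹ ^ 2 / 4) * ‖X p‖ ^ 2)]
      rw [hφp, one_mul]
      simp only [Pi.one_apply]
      linarith
    · rw [Set.indicator_of_notMem hpD]
      exact mul_nonneg (by norm_num) (mul_nonneg (hφ0 _) (Real.exp_pos _).le)
  rw [inv_pow, inv_mul_le_iff₀ (by positivity)] at h2
  have h4 := mul_le_mul_of_nonneg_left h1 (pow_nonneg hr0.le n)
  linarith

end Growth

end SelfShrinker

end

theorem mainTheorem1 (n : ℕ) (hn : 1 ≤ n) :
    ∃ C : ℝ≥0∞ → ℝ≥0, ∀ (m : ℕ) (M : Type*) [TopologicalSpace M] [T2Space M]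
      [ChartedSpace (SelfShrinker.Euc n) M] [IsManifold (𝓡 n) ∞ M] [NoncompactSpace M]
      [MeasurableSpace M] [BorelSpace M] (X : M → SelfShrinker.Euc (n + m)),
      SelfShrinker.IsSmoothImmersion n X → IsProperMap X → SelfShrinker.IsSelfShrinker n X →
      ∀ r : ℝ, 1 ≤ r →
        SelfShrinker.inducedVolume n X (X ⁻¹' Metric.ball 0 r) ≤
          (C (SelfShrinker.inducedVolume n X (X ⁻¹' Metric.ball 0 (8 * n))) : ℝ≥0∞) *
            ENNReal.ofReal (r ^ n) := by
  -- `toNNReal` sends `∞` to `0`, which is harmless: properness makes the volume of `D_{8n}` finite.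
  refine ⟨fun v => 6 * v.toNNReal, ?_⟩
  intro m M _ _ _ _ _ _ _ X hX hp hs r hr
  have h := SelfShrinker.real_inducedVolume_preimage_ball_le hn hX hp hs hr
  have hfin := (SelfShrinker.inducedVolume_preimage_ball_lt_top hX hp r).ne
  rw [← ENNReal.ofReal_coe_nnreal, ← ENNReal.ofReal_mul (NNReal.coe_nonneg _),
    ENNReal.le_ofReal_iff_toReal_le hfin (by positivity)]
  exact h
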